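/- Let $(W_t)_{0\le t\le 1}$ be a standard Brownian motion on a probability space $(\Omega,\mathcal F,\mathbf P)$, let $f,\delta:[0,1]\to\mathbb R$ be non-random functions with $\int_0^1|f(t)|\,dt<\infty$ and $\int_0^1\delta^2(t)\,dt<\infty$, and let $A:[0,1]\times\mathbb R\to\mathbb R$ be a non-random function satisfying the following two conditions. $\mathbf C_1$) There is a constant $p>0$ such that $A(t,x)=px+B(t,x)$, where $B$ is measurable in $t$ for each $x$ and bounded: $\sup_{0\le t\le1}\sup_{x\in\mathbb R}|B(t,x)|<\infty$. $\mathbf C_2$) The partial derivative $B'_x$ exists on $[0,1]\times\mathbb R$, $\sup_{0\le t\le1}\sup_{x\in\mathbb R}|B'_x(t,x)|<p$, and $$\lim_{d\to0}\ \sup_{0\le t\le1}\ \sup_{|x-y|\le d}|B'_x(t,x)-B'_x(t,y)|=0 .$$ For $\varepsilon>0$ consider the Dirichlet problem $$d\dot x^\varepsilon(t)=\varepsilon^2\bigl(A(t,x^\varepsilon(t))+f(t)\bigr)\,dt+\varepsilon^2\delta(t)\,dW_t,\qquad 0\le t\le1,\qquad x^\varepsilon(0)=x^\varepsilon(1)=0,$$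 whose solutions are processes with almost surely continuously differentiable paths on $[0,1]$ for which the equation holds in integrated form. Put $\Upsilon(t,s)=-\min(t,s)\,(1-\max(t,s))$ and $$\varkappa(t)=\int_0^1\Upsilon(t,s)\bigl(B(s,0)+f(s)\bigr)\,ds+\int_0^1\Upsilon(t,s)\,\delta(s)\,dW_s,\qquad 0\le t\le1 .$$ Then $\varkappa$ has a version with almost surely continuous paths, and we take $\varkappa$ in such a version. Moreover, there is a non-random $\varepsilon_0>0$ such that for every $0<\varepsilon\le\varepsilon_0$ the Dirichlet problem has a solution $x^\varepsilon$, unique up to indistinguishability, and $$\sup_{0\le t\le1}\bigl|\varepsilon^{-2}x^\varepsilon(t)-\varkappa(t)\bigr|\longrightarrow0\quad\text{in probability as }\varepsilon\to0^+ .$$ -/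

import Mathlib

open MeasureTheory ProbabilityTheory Filter Topology Set
open scoped ENNReal NNReal

namespace BVP

noncomputable section

/-- `W` is a standard Brownian motion on the time interval `[0,1]` under `P`. Processes are indexed
by `ℝ`; only their values at times in `[0,1]` matter. -/
structure IsBrownianOnUnit {Ω : Type*} [MeasurableSpace Ω] (W : ℝ → Ω → ℝ) (P : Measure Ω) :
    Prop where
  zero : ∀ᵐ ω ∂P, W 0 ω = 0
  law_sub : ∀ s t : ℝ, 0 ≤ s → s ≤ t → t ≤ 1 →
    HasLaw (fun ω => W t ω - W s ω) (gaussianReal 0 (t - s).toNNReal) P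
  indep_increments : ∀ (n : ℕ) (t : Fin (n + 1) → ℝ), Monotone t → (∀ i, t i ∈ Icc (0 : ℝ) 1) →
    iIndepFun (fun (i : Fin n) ω => W (t i.succ) ω - W (t i.castSucc) ω) P
  continuous_paths : ∀ᵐ ω ∂P, ContinuousOn (fun t => W t ω) (Icc 0 1)

/-- A (deterministic) step function `∑ i, coeff i * 1_(left i, right i]` on `[0,1]`. -/
structure StepFunction where
  n : ℕ
  coeff : Fin n → ℝ
  left : Fin n → ℝ
  right : Fin n → ℝ
  left_nonneg : ∀ i, 0 ≤ left i
  left_le_right : ∀ i, left i ≤ right i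
  right_le_one : ∀ i, right i ≤ 1

/-- The function represented by a step function. -/
def StepFunction.eval (S : StepFunction) (s : ℝ) : ℝ :=
  ∑ i, (Ioc (S.left i) (S.right i)).indicator (fun _ => S.coeff i) s

/-- The elementary integral `∑ i, coeff i * (W (right i) - W (left i))` of a step function. -/
def StepFunction.integral {Ω : Type*} (S : StepFunction) (W : ℝ → Ω → ℝ) (ω : Ω) : ℝ :=
  ∑ i, S.coeff i * (W (S.right i) ω - W (S.left i) ω)

/-- `ξ` is (a version of) the Wiener integral `∫_0^1 g(s) dW_s` of the deterministic function `g`: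
it is the `L²(P)`-limit of the elementary integrals of step functions tending to `g` in
`L²([0,1])`. -/
def IsWienerIntegral {Ω : Type*} [MeasurableSpace Ω] (W : ℝ → Ω → ℝ) (P : Measure Ω)
    (g : ℝ → ℝ) (ξ : Ω → ℝ) : Prop :=
  MemLp ξ 2 P ∧ ∃ S : ℕ → StepFunction,
    Tendsto (fun k => eLpNorm (fun s => g s - (S k).eval s) 2 (volume.restrict (Icc (0 : ℝ) 1)))
      atTop (𝓝 0) ∧
    Tendsto (fun k => eLpNorm (fun ω => ξ ω - (S k).integral W ω) 2 P) atTop (𝓝 0)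

open Classical in
/-- The Wiener integral `∫_0^1 g(s) dW_s`, a random variable defined up to `P`-null sets
for `g` in `L²([0,1])`. -/
def wienerIntegral {Ω : Type*} [MeasurableSpace Ω] (W : ℝ → Ω → ℝ) (P : Measure Ω)
    (g : ℝ → ℝ) : Ω → ℝ :=
  if h : ∃ ξ, IsWienerIntegral W P g ξ then h.choose else 0

/-- Condition `C₁` on `A`, with the constant `p` and the bounded function `B`. -/
structure ConditionC1 (A : ℝ → ℝ → ℝ) (p : ℝ) (B : ℝ → ℝ → ℝ) : Prop where
  p_pos : 0 < p
  eq_add : ∀ t ∈ Icc (0 : ℝ) 1, ∀ x, A t x = p * x + B t x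
  bounded : ∃ b : ℝ, ∀ t ∈ Icc (0 : ℝ) 1, ∀ x, |B t x| ≤ b

/-- Condition `C₂`: the partial derivative `B'_x` exists, `sup |B'_x| < p`, and `B'_x(t,x)` is
uniformly continuous in `x`, uniformly in `t`. -/
structure ConditionC2 (p : ℝ) (B : ℝ → ℝ → ℝ) : Prop where
  differentiable : ∀ t ∈ Icc (0 : ℝ) 1, Differentiable ℝ (B t)
  deriv_bound : ∃ β : ℝ, β < p ∧ ∀ t ∈ Icc (0 : ℝ) 1, ∀ x, |deriv (B t) x| ≤ β
  deriv_unifCont : ∀ η : ℝ, 0 < η → ∃ d : ℝ, 0 < d ∧ ∀ t ∈ Icc (0 : ℝ) 1, ∀ x y : ℝ,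
    |x - y| ≤ d → |deriv (B t) x - deriv (B t) y| ≤ η

/-- The (one-sided at the end points) time derivative of a process on `[0,1]`. -/
def timeDeriv {Ω : Type*} (x : ℝ → Ω → ℝ) (t : ℝ) (ω : Ω) : ℝ :=
  derivWithin (fun s => x s ω) (Icc 0 1) t

/-- `x` is an almost surely continuously differentiable process solving
`dẋ(t) = ε² (A(t,x(t)) + f(t)) dt + ε² δ(t) dW_t` on `[0,1]` with `x(0) = x(1) = 0`. -/
structure IsDirichletSolution {Ω : Type*} [MeasurableSpace Ω] (W : ℝ → Ω → ℝ) (P : Measure Ω)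
    (A : ℝ → ℝ → ℝ) (f δ : ℝ → ℝ) (ε : ℝ) (x : ℝ → Ω → ℝ) : Prop where
  aemeasurable : ∀ t ∈ Icc (0 : ℝ) 1, AEMeasurable (x t) P
  contDiff : ∀ᵐ ω ∂P, ContDiffOn ℝ 1 (fun t => x t ω) (Icc 0 1)
  left_boundary : ∀ᵐ ω ∂P, x 0 ω = 0
  right_boundary : ∀ᵐ ω ∂P, x 1 ω = 0
  equation : ∀ t ∈ Icc (0 : ℝ) 1, ∀ᵐ ω ∂P,
    timeDeriv x t ω = timeDeriv x 0 ω
      + ε ^ 2 * (∫ s in (0 : ℝ)..t, (A s (x s ω) + f s))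
      + ε ^ 2 * wienerIntegral W P ((Ioc 0 t).indicator δ) ω

/-- The kernel `Υ(t,s) = -min(t,s) (1 - max(t,s))`. -/
def upsilon (t s : ℝ) : ℝ := -(min t s * (1 - max t s))

/-- `κ` is the process
`κ(t) = ∫_0^1 Υ(t,s) (B(s,0) + f(s)) ds + ∫_0^1 Υ(t,s) δ(s) dW_s` on `[0,1]`, taken, as usual for
a process given by stochastic integrals depending on a parameter, in a version with almost surely
continuous paths. -/
structure IsLimitProcess {Ω : Type*} [MeasurableSpace Ω] (W : ℝ → Ω → ℝ) (P : Measure Ω)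
    (B : ℝ → ℝ → ℝ) (f δ : ℝ → ℝ) (κ : ℝ → Ω → ℝ) : Prop where
  continuous_paths : ∀ᵐ ω ∂P, ContinuousOn (fun t => κ t ω) (Icc 0 1)
  formula : ∀ t ∈ Icc (0 : ℝ) 1, ∀ᵐ ω ∂P,
    κ t ω = (∫ s in (0 : ℝ)..1, upsilon t s * (B s 0 + f s))
      + wienerIntegral W P (fun s => upsilon t s * δ s) ω

/-- The uniform norm on `[0,1]`, with values in `[0,∞]`. -/
def uniformNorm (y : ℝ → ℝ) : ℝ≥0∞ := ⨆ t ∈ Icc (0 : ℝ) 1, ‖y t‖ₑ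

end

end BVP

/-! Write `F s z = A s z + f s` and let `M` be a continuous version of `t ↦ ∫_0^t δ dW`. Integrating
the equation twice and using `x(1) = 0` to eliminate the unknown initial slope turns the Dirichlet
problem into a pathwise fixed-point equation in `C([0,1])`: `x = ε² • bridge (primitive (F(·, x)) +
M)`, where `bridge H t = ∫_0^t H - t ∫_0^1 H`.

The derivative bound makes `F` Lipschitz in space with constant `2p`, and `bridge` has norm at most
`2`. For small `ε` the map is therefore a contraction, with an `ε` threshold that does not depend on
the path. This gives existence and uniqueness; the fixed point depends continuously on `M`, hence is
measurable in `ω` (`exists_continuous_solution`). Since `x` is of order `ε²`, replacing `F(·, x)` by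
`F(·, 0)` costs only `O(ε²)` after division by `ε²`, uniformly in `t`, with a random factor that is
finite and independent of `ε` (`norm_smul_sub_bridge_le`). This yields convergence in probability.

It remains to identify `bridge (primitive (F(·, 0)) + M)` with `κ`. As `A(s,0) = B(s,0)` and `Υ(t,s)
= (t-s)⁺ - t (1-s)⁺` on the unit square, this is a Fubini theorem, deterministic for the drift and
stochastic for the noise (`isWienerIntegral_bridge`).

The probabilistic groundwork is the Itô isometry for step functions, a closure property of the
Wiener integral (`IsWienerIntegral.of_tendsto`), and the continuous version `M`, obtained from
Kolmogorov's maximal inequality and Borel–Cantelli (`exists_continuous_wienerIntegral`). -/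

namespace BVP

/-! ### Covariances of Brownian increments -/

section Increments

variable {Ω : Type*} [MeasurableSpace Ω] {P : Measure Ω} {W : ℝ → Ω → ℝ}

lemma memLp_two_of_hasLaw_gaussianReal {X : Ω → ℝ} {v : ℝ≥0} (h : HasLaw X (gaussianReal 0 v) P) :
    MemLp X 2 P := by
  have h1 : MemLp (id : ℝ → ℝ) 2 (P.map X) := by
    rw [h.map_eq]
    exact memLp_id_gaussianReal' 2 (by simp)
  exact (memLp_map_measure_iff h1.1 h.aemeasurable).1 h1

lemma IsBrownianOnUnit.memLp_increment (hW : IsBrownianOnUnit W P) {s t : ℝ} (hs : s ∈ Icc (0 : ℝ) 1)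
    (ht : t ∈ Icc (0 : ℝ) 1) : MemLp (fun ω => W t ω - W s ω) 2 P := by
  rcases le_total s t with h | h
  · exact memLp_two_of_hasLaw_gaussianReal (hW.law_sub s t hs.1 h ht.2)
  · have := (memLp_two_of_hasLaw_gaussianReal (hW.law_sub t s ht.1 h hs.2)).neg
    convert this using 2
    simp

lemma IsBrownianOnUnit.integral_increment (hW : IsBrownianOnUnit W P) {s t : ℝ} (hs : 0 ≤ s)
    (hst : s ≤ t) (ht : t ≤ 1) : ∫ ω, (W t ω - W s ω) ∂P = 0 := by
  rw [(hW.law_sub s t hs hst ht).integral_eq, integral_id_gaussianReal]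

lemma IsBrownianOnUnit.integral_increment_sq (hW : IsBrownianOnUnit W P) {s t : ℝ}
    (hs : s ∈ Icc (0 : ℝ) 1) (ht : t ∈ Icc (0 : ℝ) 1) :
    ∫ ω, (W t ω - W s ω) ^ 2 ∂P = |t - s| := by
  wlog h : s ≤ t generalizing s t
  · rw [abs_sub_comm, ← this ht hs (le_of_not_ge h)]
    exact integral_congr_ae (ae_of_all _ fun ω => by ring)
  have hl := hW.law_sub s t hs.1 h ht.2
  have h1 := hl.variance_eq
  rw [variance_id_gaussianReal, variance_eq_integral hl.aemeasurable,
    hW.integral_increment hs.1 h ht.2] at h1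
  simp only [sub_zero] at h1
  rw [h1, Real.coe_toNNReal _ (sub_nonneg.2 h), abs_of_nonneg (sub_nonneg.2 h)]

/-- Polarisation: the product is a signed half-sum of squares of four increments, so variances alone
suffice and the relative position of the two intervals plays no role. -/
lemma IsBrownianOnUnit.integral_increment_mul_increment (hW : IsBrownianOnUnit W P) {a b c d : ℝ}
    (ha : a ∈ Icc (0 : ℝ) 1) (hb : b ∈ Icc (0 : ℝ) 1) (hc : c ∈ Icc (0 : ℝ) 1)
    (hd : d ∈ Icc (0 : ℝ) 1) :
    ∫ ω, (W b ω - W a ω) * (W d ω - W c ω) ∂P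
      = (|b - c| + |a - d| - |b - d| - |a - c|) / 2 := by
  have i1 := (hW.memLp_increment hc hb).integrable_sq
  have i2 := (hW.memLp_increment hd ha).integrable_sq
  have i3 := (hW.memLp_increment hd hb).integrable_sq
  have i4 := (hW.memLp_increment hc ha).integrable_sq
  have h : (fun ω => (W b ω - W a ω) * (W d ω - W c ω)) = fun ω =>
      ((W b ω - W c ω) ^ 2 + (W a ω - W d ω) ^ 2 - (W b ω - W d ω) ^ 2 - (W a ω - W c ω) ^ 2) / 2 := by
    ext ω
    ring
  rw [h, integral_div, MeasureTheory.integral_sub ?_ i4, MeasureTheory.integral_sub ?_ i3,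
    integral_add i1 i2, hW.integral_increment_sq hc hb, hW.integral_increment_sq hd ha,
    hW.integral_increment_sq hd hb, hW.integral_increment_sq hc ha]
  exacts [i1.add i2, (i1.add i2).sub i3]

/-- The length of the overlap of two intervals, put in the same four-distance form as the covariance
of increments, so that the isometry follows by comparing terms. -/
lemma integral_indicator_Ioc_mul_indicator_Ioc {a b c d : ℝ}
    (ha : 0 ≤ a) (hab : a ≤ b) (hb : b ≤ 1) (hcd : c ≤ d) :
    ∫ s in Icc (0 : ℝ) 1, (Ioc a b).indicator (fun _ => (1 : ℝ)) s *
        (Ioc c d).indicator (fun _ => (1 : ℝ)) s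
      = (|b - c| + |a - d| - |b - d| - |a - c|) / 2 := by
  have h1 : (fun s : ℝ => (Ioc a b).indicator (fun _ => (1 : ℝ)) s *
      (Ioc c d).indicator (fun _ => (1 : ℝ)) s)
      = (Ioc (max a c) (min b d)).indicator (fun _ => (1 : ℝ)) := by
    ext s
    rw [← Ioc_inter_Ioc, ← Set.inter_indicator_mul]
    simp
  have h2 : Ioc (max a c) (min b d) ∩ Icc 0 1 = Ioc (max a c) (min b d) := by
    refine inter_eq_left.2 fun s hs => ⟨?_, ?_⟩
    · exact ha.trans ((le_max_left _ _).trans hs.1.le)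
    · exact hs.2.trans ((min_le_left _ _).trans hb)
  rw [h1, integral_indicator measurableSet_Ioc, Measure.restrict_restrict measurableSet_Ioc, h2]
  simp only [integral_const, MeasurableSet.univ, measureReal_restrict_apply, univ_inter,
    Real.volume_real_Ioc, smul_eq_mul, mul_one]
  rcases le_total a c with h | h <;> rcases le_total b d with h' | h' <;>
    rcases le_total b c with h3 | h3 <;> rcases le_total a d with h4 | h4 <;>
    simp only [max_eq_left, max_eq_right, min_eq_left, min_eq_right, abs_of_nonneg, abs_of_nonpos,
      sub_nonneg, sub_nonpos, h, h', h3, h4] <;>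
    first
    | linarith
    | (rw [max_eq_left (by linarith)]; linarith)

end Increments

section Gram

variable {α : Type*} [MeasurableSpace α] {μ : Measure α}

lemma integral_sum_mul_sq {n : ℕ} (c : Fin n → ℝ) (X : Fin n → α → ℝ)
    (hX : ∀ i, MemLp (X i) 2 μ) :
    ∫ x, (∑ i, c i * X i x) ^ 2 ∂μ = ∑ i, ∑ j, c i * c j * ∫ x, X i x * X j x ∂μ := by
  have h (i j) : Integrable (fun x => c i * c j * (X i x * X j x)) μ :=
    ((hX i).integrable_mul (hX j)).const_mul _
  simp only [← integral_const_mul]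
  rw [← integral_congr_ae (ae_of_all _ fun x => ?_), integral_finsetSum _ fun i _ =>
    integrable_finsetSum _ fun j _ => h i j]
  · exact Finset.sum_congr rfl fun i _ => integral_finsetSum _ fun j _ => h i j
  · simp only [sq, Finset.sum_mul_sum]
    exact Finset.sum_congr rfl fun i _ => Finset.sum_congr rfl fun j _ => by ring

lemma eLpNorm_two_eq_ofReal_sqrt {f : α → ℝ} (hf : MemLp f 2 μ) :
    eLpNorm f 2 μ = ENNReal.ofReal (√(∫ x, f x ^ 2 ∂μ)) := by
  rw [hf.eLpNorm_eq_integral_rpow_norm (by simp) (by simp), Real.sqrt_eq_rpow]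
  simp

end Gram

/-! ### Algebra of step functions and the Itô isometry -/

namespace StepFunction

/-- The sum of two step functions. -/
def add (S T : StepFunction) : StepFunction where
  n := S.n + T.n
  coeff := Fin.append S.coeff T.coeff
  left := Fin.append S.left T.left
  right := Fin.append S.right T.right
  left_nonneg i := by
    refine Fin.addCases (fun j => ?_) (fun j => ?_) i
    · simpa using S.left_nonneg j
    · simpa using T.left_nonneg j
  left_le_right i := by
    refine Fin.addCases (fun j => ?_) (fun j => ?_) i
    · simpa using S.left_le_right j
    · simpa using T.left_le_right j
  right_le_one i := by
    refine Fin.addCases (fun j => ?_) (fun j => ?_) i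
    · simpa using S.right_le_one j
    · simpa using T.right_le_one j

/-- A scalar multiple of a step function. -/
def smul (a : ℝ) (S : StepFunction) : StepFunction :=
  { S with coeff := fun i => a * S.coeff i }

/-- The difference of two step functions. -/
def sub (S T : StepFunction) : StepFunction := S.add (T.smul (-1))

/-- The step function that agrees with `S` up to time `t` and vanishes afterwards. -/
def trunc (S : StepFunction) {t : ℝ} (ht : 0 ≤ t) : StepFunction where
  n := S.n
  coeff := S.coeff
  left i := min (S.left i) t
  right i := min (S.right i) t
  left_nonneg i := le_min (S.left_nonneg i) ht
  left_le_right i := min_le_min_right t (S.left_le_right i)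
  right_le_one i := (min_le_left _ _).trans (S.right_le_one i)

lemma left_mem (S : StepFunction) (i) : S.left i ∈ Icc (0 : ℝ) 1 :=
  ⟨S.left_nonneg i, (S.left_le_right i).trans (S.right_le_one i)⟩

lemma right_mem (S : StepFunction) (i) : S.right i ∈ Icc (0 : ℝ) 1 :=
  ⟨(S.left_nonneg i).trans (S.left_le_right i), S.right_le_one i⟩

lemma eval_eq_sum (S : StepFunction) (s : ℝ) :
    S.eval s = ∑ i, S.coeff i * (Ioc (S.left i) (S.right i)).indicator (fun _ => (1 : ℝ)) s := by
  refine Finset.sum_congr rfl fun i _ => ?_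
  by_cases h : s ∈ Ioc (S.left i) (S.right i) <;> simp [h]

@[simp] lemma eval_add (S T : StepFunction) (s : ℝ) : (S.add T).eval s = S.eval s + T.eval s := by
  simp only [eval]
  exact (Fin.sum_univ_add _).trans (by simp [add])

@[simp] lemma eval_smul (a : ℝ) (S : StepFunction) (s : ℝ) :
    (S.smul a).eval s = a * S.eval s := by
  simp only [eval_eq_sum, Finset.mul_sum, ← mul_assoc]
  rfl

@[simp] lemma eval_sub (S T : StepFunction) (s : ℝ) : (S.sub T).eval s = S.eval s - T.eval s := by
  simp [sub, sub_eq_add_neg]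

lemma eval_trunc (S : StepFunction) {t : ℝ} (ht : 0 ≤ t) (s : ℝ) :
    (S.trunc ht).eval s = (Ioc 0 t).indicator S.eval s := by
  by_cases h : s ∈ Ioc 0 t
  · rw [indicator_of_mem h]
    refine Finset.sum_congr rfl fun i _ => ?_
    have : s ∈ Ioc (min (S.left i) t) (min (S.right i) t) ↔ s ∈ Ioc (S.left i) (S.right i) := by
      simp only [mem_Ioc, min_lt_iff, le_min_iff, h.2, and_true, not_lt.2 h.2, or_false]
    by_cases h' : s ∈ Ioc (S.left i) (S.right i)
    · rw [indicator_of_mem h']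
      exact indicator_of_mem (this.2 h') _
    · rw [indicator_of_notMem h']
      exact indicator_of_notMem (fun h2 => h' (this.1 h2)) _
  · rw [indicator_of_notMem h]
    refine Finset.sum_eq_zero fun i _ => indicator_of_notMem (fun h2 => h ⟨?_, ?_⟩) _
    · exact (le_min (S.left_nonneg i) ht).trans_lt h2.1
    · exact h2.2.trans (min_le_right _ _)

section

variable {Ω : Type*} {W : ℝ → Ω → ℝ}

@[simp] lemma integral_add (S T : StepFunction) (ω : Ω) :
    (S.add T).integral W ω = S.integral W ω + T.integral W ω := by
  simp only [integral]
  exact (Fin.sum_univ_add _).trans (by simp [add])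

@[simp] lemma integral_smul (a : ℝ) (S : StepFunction) (ω : Ω) :
    (S.smul a).integral W ω = a * S.integral W ω := by
  simp only [integral, Finset.mul_sum, ← mul_assoc]
  rfl

@[simp] lemma integral_sub (S T : StepFunction) (ω : Ω) :
    (S.sub T).integral W ω = S.integral W ω - T.integral W ω := by
  simp [sub, sub_eq_add_neg]

end

lemma memLp_eval (S : StepFunction) : MemLp S.eval 2 (volume.restrict (Icc (0 : ℝ) 1)) := by
  have : S.eval = fun s => ∑ i, (Ioc (S.left i) (S.right i)).indicator (fun _ => S.coeff i) s := rfl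
  rw [this]
  exact memLp_finsetSum _ fun i _ => (memLp_const _).indicator measurableSet_Ioc

variable {Ω : Type*} [MeasurableSpace Ω] {P : Measure Ω} {W : ℝ → Ω → ℝ}

lemma memLp_integral (hW : IsBrownianOnUnit W P) (S : StepFunction) :
    MemLp (S.integral W) 2 P :=
  memLp_finsetSum _ fun i _ => (hW.memLp_increment (S.left_mem i) (S.right_mem i)).const_mul _

/-- The Itô isometry for step functions. -/
lemma integral_integral_sq (hW : IsBrownianOnUnit W P) (S : StepFunction) :
    ∫ ω, S.integral W ω ^ 2 ∂P = ∫ s in Icc (0 : ℝ) 1, S.eval s ^ 2 := by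
  simp only [eval_eq_sum, integral]
  rw [integral_sum_mul_sq _ _ fun i => hW.memLp_increment (S.left_mem i) (S.right_mem i),
    integral_sum_mul_sq _ _ fun i => (memLp_const _).indicator measurableSet_Ioc]
  refine Finset.sum_congr rfl fun i _ => Finset.sum_congr rfl fun j _ => ?_
  rw [hW.integral_increment_mul_increment (S.left_mem i) (S.right_mem i) (S.left_mem j) (S.right_mem j),
    integral_indicator_Ioc_mul_indicator_Ioc (S.left_nonneg i) (S.left_le_right i)
      (S.right_le_one i) (S.left_le_right j)]

lemma eLpNorm_integral (hW : IsBrownianOnUnit W P) (S : StepFunction) :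
    eLpNorm (S.integral W) 2 P = eLpNorm S.eval 2 (volume.restrict (Icc (0 : ℝ) 1)) := by
  rw [eLpNorm_two_eq_ofReal_sqrt (S.memLp_integral hW), eLpNorm_two_eq_ofReal_sqrt S.memLp_eval,
    S.integral_integral_sq hW]

end StepFunction

/-! ### Linearity, uniqueness and closure of the Wiener integral -/

section WienerIntegral

variable {Ω : Type*} [MeasurableSpace Ω] {P : Measure Ω} {W : ℝ → Ω → ℝ}

lemma eLpNorm_fun_sub_comm {α : Type*} [MeasurableSpace α] {μ : Measure α} (f g : α → ℝ) :
    eLpNorm (fun x => f x - g x) 2 μ = eLpNorm (fun x => g x - f x) 2 μ :=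
  eLpNorm_congr_norm_ae (ae_of_all _ fun x => norm_sub_rev (f x) (g x))

lemma eLpNorm_sub_le_add {α : Type*} [MeasurableSpace α] {μ : Measure α} {f g h : α → ℝ}
    (hf : AEStronglyMeasurable f μ) (hg : AEStronglyMeasurable g μ)
    (hh : AEStronglyMeasurable h μ) :
    eLpNorm (fun x => f x - h x) 2 μ
      ≤ eLpNorm (fun x => f x - g x) 2 μ + eLpNorm (fun x => g x - h x) 2 μ := by
  refine (eLpNorm_congr_ae (ae_of_all _ fun x => ?_)).trans_le
    (eLpNorm_add_le (hf.sub hg) (hg.sub hh) (by norm_num))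
  simp

lemma eLpNorm_le_sub_add {α : Type*} [MeasurableSpace α] {μ : Measure α} {f g : α → ℝ}
    (hf : AEStronglyMeasurable f μ) (hg : AEStronglyMeasurable g μ) :
    eLpNorm f 2 μ ≤ eLpNorm (fun x => f x - g x) 2 μ + eLpNorm g 2 μ := by
  simpa using eLpNorm_sub_le_add hf hg (aestronglyMeasurable_const (b := (0 : ℝ)))

lemma StepFunction.isWienerIntegral (hW : IsBrownianOnUnit W P) (S : StepFunction) :
    IsWienerIntegral W P S.eval (S.integral W) :=
  ⟨S.memLp_integral hW, fun _ => S, by simp, by simp⟩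

lemma IsWienerIntegral.const_smul {g : ℝ → ℝ} {ξ : Ω → ℝ} (h : IsWienerIntegral W P g ξ) (a : ℝ) :
    IsWienerIntegral W P (fun s => a * g s) (fun ω => a * ξ ω) := by
  obtain ⟨hξ, S, h1, h2⟩ := h
  refine ⟨hξ.const_mul a, fun k => (S k).smul a, ?_, ?_⟩
  · have := ENNReal.Tendsto.const_mul h1 (Or.inr (enorm_ne_top (x := a)))
    rw [mul_zero] at this
    refine this.congr fun k => ?_
    rw [← eLpNorm_const_smul]
    congr 1
    ext s
    simp [mul_sub]
  · have := ENNReal.Tendsto.const_mul h2 (Or.inr (enorm_ne_top (x := a)))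
    rw [mul_zero] at this
    refine this.congr fun k => ?_
    rw [← eLpNorm_const_smul]
    congr 1
    ext s
    simp [mul_sub]

lemma IsWienerIntegral.add (hW : IsBrownianOnUnit W P) {g h : ℝ → ℝ} {ξ ζ : Ω → ℝ}
    (hg : AEStronglyMeasurable g (volume.restrict (Icc (0 : ℝ) 1)))
    (hh : AEStronglyMeasurable h (volume.restrict (Icc (0 : ℝ) 1)))
    (h1 : IsWienerIntegral W P g ξ) (h2 : IsWienerIntegral W P h ζ) :
    IsWienerIntegral W P (fun s => g s + h s) (fun ω => ξ ω + ζ ω) := by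
  obtain ⟨hξ, S, h1, h1'⟩ := h1
  obtain ⟨hζ, T, h2, h2'⟩ := h2
  refine ⟨hξ.add hζ, fun k => (S k).add (T k), ?_, ?_⟩
  · have := h1.add h2
    rw [add_zero] at this
    refine tendsto_of_tendsto_of_tendsto_of_le_of_le tendsto_const_nhds this
      (fun _ => zero_le) fun k => ?_
    refine (eLpNorm_congr_ae (ae_of_all _ fun x => ?_)).trans_le (eLpNorm_add_le
      (hg.sub (S k).memLp_eval.1) (hh.sub (T k).memLp_eval.1) (by norm_num))
    simp only [StepFunction.eval_add, Pi.add_apply]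
    ring
  · have := h1'.add h2'
    rw [add_zero] at this
    refine tendsto_of_tendsto_of_tendsto_of_le_of_le tendsto_const_nhds this
      (fun _ => zero_le) fun k => ?_
    refine (eLpNorm_congr_ae (ae_of_all _ fun x => ?_)).trans_le (eLpNorm_add_le
      (hξ.1.sub ((S k).memLp_integral hW).1) (hζ.1.sub ((T k).memLp_integral hW).1) (by norm_num))
    simp only [StepFunction.integral_add, Pi.add_apply]
    ring

lemma IsWienerIntegral.sub (hW : IsBrownianOnUnit W P) {g h : ℝ → ℝ} {ξ ζ : Ω → ℝ}
    (hg : AEStronglyMeasurable g (volume.restrict (Icc (0 : ℝ) 1)))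
    (hh : AEStronglyMeasurable h (volume.restrict (Icc (0 : ℝ) 1)))
    (h1 : IsWienerIntegral W P g ξ) (h2 : IsWienerIntegral W P h ζ) :
    IsWienerIntegral W P (fun s => g s - h s) (fun ω => ξ ω - ζ ω) := by
  have := h1.add hW hg (hh.const_mul (-1)) (h2.const_smul (-1))
  simpa [sub_eq_add_neg] using this

lemma IsWienerIntegral.sum (hW : IsBrownianOnUnit W P) {ι : Type*} (s : Finset ι)
    {g : ι → ℝ → ℝ} {ξ : ι → Ω → ℝ}
    (hg : ∀ i ∈ s, AEStronglyMeasurable (g i) (volume.restrict (Icc (0 : ℝ) 1)))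
    (h : ∀ i ∈ s, IsWienerIntegral W P (g i) (ξ i)) :
    IsWienerIntegral W P (fun u => ∑ i ∈ s, g i u) (fun ω => ∑ i ∈ s, ξ i ω) := by
  classical
  induction s using Finset.induction_on with
  | empty =>
    have h0 := (StepFunction.mk 0 ![] ![] ![] (by simp) (by simp) (by simp)).isWienerIntegral hW
    convert h0 using 1 <;> ext u <;> simp [StepFunction.eval, StepFunction.integral]
  | insert i s hi ih =>
    simp only [Finset.sum_insert hi]
    refine (h i (Finset.mem_insert_self i s)).add hW (hg i (Finset.mem_insert_self i s))
      (Finset.aestronglyMeasurable_fun_sum _ fun j hj => hg j (Finset.mem_insert_of_mem hj))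
      (ih (fun j hj => hg j (Finset.mem_insert_of_mem hj))
        fun j hj => h j (Finset.mem_insert_of_mem hj))

lemma IsWienerIntegral.congr {g h : ℝ → ℝ} {ξ : Ω → ℝ}
    (hgh : g =ᵐ[volume.restrict (Icc (0 : ℝ) 1)] h) (hg : IsWienerIntegral W P g ξ) :
    IsWienerIntegral W P h ξ := by
  obtain ⟨hξ, S, h1, h2⟩ := hg
  refine ⟨hξ, S, h1.congr fun k => eLpNorm_congr_ae ?_, h2⟩
  filter_upwards [hgh] with s hs
  rw [hs]

/-- The isometry for step functions passes to the limit. This inequality is the half needed for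
uniqueness and for closure under limits. -/
lemma IsWienerIntegral.eLpNorm_le (hW : IsBrownianOnUnit W P) {g : ℝ → ℝ} {ξ : Ω → ℝ}
    (hg : AEStronglyMeasurable g (volume.restrict (Icc (0 : ℝ) 1)))
    (h : IsWienerIntegral W P g ξ) :
    eLpNorm ξ 2 P ≤ eLpNorm g 2 (volume.restrict (Icc (0 : ℝ) 1)) := by
  obtain ⟨hξ, S, h1, h2⟩ := h
  have hlim := (h2.add h1).add_const (eLpNorm g 2 (volume.restrict (Icc (0 : ℝ) 1)))
  rw [add_zero, zero_add] at hlim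
  refine ge_of_tendsto' hlim fun k => ?_
  refine (eLpNorm_le_sub_add hξ.1 ((S k).memLp_integral hW).1).trans ?_
  rw [add_assoc, (S k).eLpNorm_integral hW, eLpNorm_fun_sub_comm g]
  gcongr
  exact eLpNorm_le_sub_add (S k).memLp_eval.1 hg

/-- The difference of two versions is a Wiener integral of zero, so its norm vanishes. -/
lemma IsWienerIntegral.ae_eq (hW : IsBrownianOnUnit W P) {g : ℝ → ℝ} {ξ ζ : Ω → ℝ}
    (hg : AEStronglyMeasurable g (volume.restrict (Icc (0 : ℝ) 1)))
    (h1 : IsWienerIntegral W P g ξ) (h2 : IsWienerIntegral W P g ζ) : ξ =ᵐ[P] ζ := by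
  have h := (h1.sub hW hg hg h2).eLpNorm_le hW (hg.sub hg)
  simp only [sub_self, eLpNorm_zero, nonpos_iff_eq_zero] at h
  replace h := (eLpNorm_eq_zero_iff (h1.1.1.sub h2.1.1) (by norm_num)).1 h
  filter_upwards [h] with ω hω
  exact sub_eq_zero.1 hω

/-- `wienerIntegral` is an arbitrary choice of version; this lets any explicit version replace it.
-/
lemma IsWienerIntegral.wienerIntegral_ae_eq (hW : IsBrownianOnUnit W P) {g : ℝ → ℝ} {ξ : Ω → ℝ}
    (hg : AEStronglyMeasurable g (volume.restrict (Icc (0 : ℝ) 1)))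
    (h : IsWienerIntegral W P g ξ) : wienerIntegral W P g =ᵐ[P] ξ := by
  have hex : ∃ ξ, IsWienerIntegral W P g ξ := ⟨ξ, h⟩
  rw [wienerIntegral, dif_pos hex]
  exact hex.choose_spec.ae_eq hW hg h

/-- The Wiener integral is closed under `L²` convergence of the integrands combined with almost
sure convergence of the integrals. -/
lemma IsWienerIntegral.of_tendsto (hW : IsBrownianOnUnit W P) {g : ℝ → ℝ} {G : ℕ → ℝ → ℝ}
    {ξ : Ω → ℝ} {Ξ : ℕ → Ω → ℝ}
    (hg : AEStronglyMeasurable g (volume.restrict (Icc (0 : ℝ) 1)))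
    (hG : ∀ n, AEStronglyMeasurable (G n) (volume.restrict (Icc (0 : ℝ) 1)))
    (hΞ : ∀ n, IsWienerIntegral W P (G n) (Ξ n))
    (hlim : Tendsto (fun n => eLpNorm (fun s => g s - G n s) 2 (volume.restrict (Icc (0 : ℝ) 1)))
      atTop (𝓝 0))
    (hξ : ∀ᵐ ω ∂P, Tendsto (fun n => Ξ n ω) atTop (𝓝 (ξ ω))) :
    IsWienerIntegral W P g ξ := by
  have hξm : AEStronglyMeasurable ξ P :=
    aestronglyMeasurable_of_tendsto_ae atTop (fun n => (hΞ n).1.1) hξ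
  -- Fatou in `m`, with `n` fixed, converts almost sure convergence into an `L²` estimate: `‖Ξ m - Ξ
  -- n‖` is controlled by `‖G m - G n‖`, which is at most `‖g - G m‖ + ‖g - G n‖`.
  have hdist (n : ℕ) : eLpNorm (fun ω => ξ ω - Ξ n ω) 2 P
      ≤ eLpNorm (fun s => g s - G n s) 2 (volume.restrict (Icc (0 : ℝ) 1)) := by
    have h1 : eLpNorm (fun ω => ξ ω - Ξ n ω) 2 P
        ≤ liminf (fun m => eLpNorm (fun ω => Ξ m ω - Ξ n ω) 2 P) atTop := by
      refine Lp.eLpNorm_lim_le_liminf_eLpNorm (fun m => (hΞ m).1.1.sub (hΞ n).1.1) _ ?_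
      filter_upwards [hξ] with ω hω
      exact hω.sub_const _
    have h2 := hlim.add_const
      (eLpNorm (fun s => g s - G n s) 2 (volume.restrict (Icc (0 : ℝ) 1)))
    rw [zero_add] at h2
    rw [← h2.liminf_eq]
    refine h1.trans (liminf_le_liminf (Eventually.of_forall fun m => ?_))
    refine (((hΞ m).sub hW (hG m) (hG n) (hΞ n)).eLpNorm_le hW ((hG m).sub (hG n))).trans ?_
    rw [eLpNorm_fun_sub_comm g (G m)]
    exact eLpNorm_sub_le_add (hG m) hg (hG n)
  have hpos (n : ℕ) : (0 : ℝ≥0∞) < ((n : ℝ≥0∞) + 1)⁻¹ := by simp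
  -- Diagonal choice: one step function close to `G n` whose elementary integral is equally close to
  -- `Ξ n`.
  have hstep (n : ℕ) : ∃ S : StepFunction,
      eLpNorm (fun s => G n s - S.eval s) 2 (volume.restrict (Icc (0 : ℝ) 1))
        ≤ ((n : ℝ≥0∞) + 1)⁻¹ ∧
      eLpNorm (fun ω => Ξ n ω - S.integral W ω) 2 P ≤ ((n : ℝ≥0∞) + 1)⁻¹ := by
    obtain ⟨_, S, h1, h2⟩ := hΞ n
    obtain ⟨k, hk⟩ := ((h1.eventually_le_const (hpos n)).and
      (h2.eventually_le_const (hpos n))).exists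
    exact ⟨S k, hk⟩
  choose S hS1 hS2 using hstep
  have hinv : Tendsto (fun n : ℕ => ((n : ℝ≥0∞) + 1)⁻¹) atTop (𝓝 0) := by
    have := (tendsto_add_atTop_iff_nat 1).2 ENNReal.tendsto_inv_nat_nhds_zero
    simpa using this
  have hsum := hlim.add hinv
  rw [add_zero] at hsum
  refine ⟨⟨hξm, ?_⟩, S, ?_, ?_⟩
  · obtain ⟨n, hn⟩ := (hlim.eventually_lt_const ENNReal.zero_lt_top).exists
    exact (eLpNorm_le_sub_add hξm (hΞ n).1.1).trans_lt
      (ENNReal.add_lt_top.2 ⟨(hdist n).trans_lt hn, (hΞ n).1.2⟩)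
  · exact tendsto_of_tendsto_of_tendsto_of_le_of_le tendsto_const_nhds hsum (fun _ => zero_le)
      fun n => (eLpNorm_sub_le_add hg (hG n) (S n).memLp_eval.1).trans
        (add_le_add le_rfl (hS1 n))
  · exact tendsto_of_tendsto_of_tendsto_of_le_of_le tendsto_const_nhds hsum (fun _ => zero_le)
      fun n => (eLpNorm_sub_le_add hξm (hΞ n).1.1 ((S n).memLp_integral hW).1).trans
        (add_le_add (hdist n) (hS2 n))

end WienerIntegral

/-! ### Density of step functions in `L²([0,1])` -/

section Density

/-- The step function with value `φ (i / n)` on `(i / n, (i + 1) / n]`. -/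
noncomputable def StepFunction.ofFun (φ : ℝ → ℝ) (n : ℕ) : StepFunction where
  n := n
  coeff i := φ ((i : ℝ) / n)
  left i := (i : ℝ) / n
  right i := ((i : ℝ) + 1) / n
  left_nonneg i := by positivity
  left_le_right i := by gcongr; linarith
  right_le_one i := div_le_one_of_le₀ (by exact_mod_cast i.2) (by positivity)

lemma StepFunction.eval_ofFun (φ : ℝ → ℝ) {n : ℕ} (hn : 0 < n) {s : ℝ} (hs : s ∈ Ioc (0 : ℝ) 1) :
    ∃ u ∈ Icc (0 : ℝ) 1, |u - s| ≤ 1 / n ∧ (StepFunction.ofFun φ n).eval s = φ u := by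
  have hn' : (0 : ℝ) < n := by exact_mod_cast hn
  have hpos : 0 < s * n := mul_pos hs.1 hn'
  -- The cells are open on the left, so the one containing `s` has index `⌈s n⌉ - 1`.
  obtain ⟨j, hj⟩ : ∃ j : ℕ, ⌈s * n⌉₊ = j + 1 :=
    Nat.exists_eq_succ_of_ne_zero (Nat.ceil_pos.2 hpos).ne'
  have hlt : (j : ℝ) < s * n := by
    have := Nat.ceil_lt_add_one hpos.le
    rw [hj] at this
    push_cast at this
    linarith
  have hle : s * n ≤ j + 1 := by
    have := Nat.le_ceil (s * n)
    rw [hj] at this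
    exact_mod_cast this
  have hjn : j < n := by
    have : (j : ℝ) < n := hlt.trans_le (by nlinarith [hs.2])
    exact_mod_cast this
  refine ⟨(j : ℝ) / n, ⟨by positivity, div_le_one_of_le₀ (by exact_mod_cast hjn.le) hn'.le⟩, ?_, ?_⟩
  · rw [abs_le]
    constructor
    · rw [neg_le_sub_iff_le_add, ← add_div, le_div_iff₀ hn']
      exact hle
    · have : (j : ℝ) / n ≤ s := (div_le_iff₀ hn').2 hlt.le
      have : 0 ≤ 1 / (n : ℝ) := by positivity
      linarith
  · have hval : ∀ i : Fin n, s ∈ Ioc ((i : ℝ) / n) (((i : ℝ) + 1) / n) ↔ i = ⟨j, hjn⟩ := by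
      intro i
      rw [mem_Ioc, div_lt_iff₀ hn', le_div_iff₀ hn', Fin.ext_iff]
      constructor
      · rintro ⟨h1, h2⟩
        have h3 : (i : ℝ) < j + 1 := h1.trans_le hle
        have h4 : (j : ℝ) < i + 1 := hlt.trans_le h2
        norm_cast at h3 h4
        simp only
        omega
      · intro h
        simp only at h
        rw [h]
        exact ⟨hlt, hle⟩
    change ∑ i : Fin n, (Ioc ((i : ℝ) / n) (((i : ℝ) + 1) / n)).indicator
      (fun _ => φ ((i : ℝ) / n)) s = _
    rw [Finset.sum_eq_single (⟨j, hjn⟩ : Fin n)]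
    · exact indicator_of_mem ((hval _).2 rfl) _
    · intro i _ hi
      exact indicator_of_notMem (fun h => hi ((hval i).1 h)) _
    · simp

lemma exists_stepFunction_eLpNorm_sub_le {g : ℝ → ℝ}
    (hg : MemLp g 2 (volume.restrict (Icc (0 : ℝ) 1))) {ε : ℝ≥0∞} (hε : ε ≠ 0) :
    ∃ S : StepFunction,
      eLpNorm (fun s => g s - S.eval s) 2 (volume.restrict (Icc (0 : ℝ) 1)) ≤ ε := by
  obtain ⟨φ, hφ, hφm⟩ := hg.exists_boundedContinuous_eLpNorm_sub_le (by simp)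
    (ENNReal.half_pos hε).ne'
  -- `ε` may be infinite, whereas uniform continuity needs a real tolerance.
  obtain ⟨r, hr0, hr⟩ : ∃ r : ℝ, 0 < r ∧ ENNReal.ofReal r ≤ ε / 2 := by
    rcases eq_or_ne (ε / 2) ∞ with h | h
    · exact ⟨1, one_pos, h ▸ le_top⟩
    · exact ⟨(ε / 2).toReal, ENNReal.toReal_pos (ENNReal.half_pos hε).ne' h,
        ENNReal.ofReal_toReal_le⟩
  have huc := isCompact_Icc.uniformContinuousOn_of_continuous
    (φ.continuous.continuousOn (s := Icc (0 : ℝ) 1))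
  obtain ⟨d, hd, hφd⟩ := Metric.uniformContinuousOn_iff_le.1 huc r hr0
  obtain ⟨n, hn⟩ := exists_nat_one_div_lt hd
  refine ⟨StepFunction.ofFun φ (n + 1), ?_⟩
  refine (eLpNorm_sub_le_add hg.1 hφm.1 (StepFunction.memLp_eval _).1).trans ?_
  rw [← ENNReal.add_halves ε]
  refine add_le_add hφ (le_trans ?_ hr)
  -- The point `0` lies in no left-open cell and has to be discarded.
  have hne : ∀ᵐ s ∂(volume.restrict (Icc (0 : ℝ) 1)), s ≠ 0 :=
    ae_restrict_of_ae (Measure.ae_ne _ 0)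
  refine (eLpNorm_le_of_ae_bound (C := r) ?_).trans (by simp)
  filter_upwards [hne, ae_restrict_mem measurableSet_Icc] with s hs0 hs
  obtain ⟨u, hu, hus, he⟩ := StepFunction.eval_ofFun φ n.succ_pos ⟨hs.1.lt_of_ne' hs0, hs.2⟩
  rw [he, ← dist_eq_norm]
  refine hφd _ hs _ hu ?_
  rw [dist_comm, Real.dist_eq]
  refine hus.trans ?_
  push_cast
  exact hn.le

end Density

/-! ### Kolmogorov's maximal inequality -/

section MaximalInequality

variable {Ω : Type*} [MeasurableSpace Ω] {P : Measure Ω} [IsProbabilityMeasure P]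

lemma submartingale_sum_sq {ξ : ℕ → Ω → ℝ} (hm : ∀ i, StronglyMeasurable (ξ i))
    (hξ : ∀ i, MemLp (ξ i) 2 P) (hind : iIndepFun ξ P) (hmean : ∀ i, ∫ ω, ξ i ω ∂P = 0) :
    Submartingale (fun k ω => (∑ i ∈ Finset.range (k + 1), ξ i ω) ^ 2)
      (Filtration.natural ξ hm) P := by
  have hL (k : ℕ) : MemLp (fun ω => ∑ i ∈ Finset.range (k + 1), ξ i ω) 2 P :=
    memLp_finsetSum _ fun i _ => hξ i
  have hadS (k : ℕ) : StronglyMeasurable[Filtration.natural ξ hm k]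
      (fun ω => ∑ i ∈ Finset.range (k + 1), ξ i ω) :=
    Finset.stronglyMeasurable_fun_sum _ fun i hi =>
      ((Filtration.stronglyAdapted_natural hm) i).mono
        ((Filtration.natural ξ hm).mono (by simpa [Nat.lt_succ_iff] using hi))
  refine submartingale_of_setIntegral_le_succ (fun k => (hadS k).pow 2)
    (fun k => (hL k).integrable_sq) fun k s hs => ?_
  have hs' : MeasurableSet s := (Filtration.natural ξ hm).le k _ hs
  set X : Ω → ℝ := fun ω => ∑ i ∈ Finset.range (k + 1), ξ i ω with hX
  -- `1_s X` depends only on the first `k + 1` variables, so it is independent of the centred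
  -- variable `ξ (k + 1)`. The cross term vanishes and the conditional growth is a square.
  have hcross : ∫ ω in s, X ω * ξ (k + 1) ω ∂P = 0 := by
    have hi : IndepFun (s.indicator X) (ξ (k + 1)) P := by
      have h := (hind.indep_comap_natural_of_lt hm (Nat.lt_succ_self k)).symm
      rw [IndepFun_iff_Indep]
      refine indep_of_indep_of_le_left h ?_
      exact ((hadS k).indicator hs).measurable.comap_le
    have h1 := hi.integral_fun_mul_eq_mul_integral
      (((hL k).1).indicator hs') (hξ (k + 1)).1
    rw [hmean, mul_zero] at h1
    rw [← h1, ← integral_indicator hs']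
    refine integral_congr_ae (ae_of_all _ fun ω => ?_)
    by_cases hω : ω ∈ s <;> simp [hω]
  have hexp : (fun ω => (∑ i ∈ Finset.range (k + 1 + 1), ξ i ω) ^ 2)
      = fun ω => X ω ^ 2 + 2 * (X ω * ξ (k + 1) ω) + ξ (k + 1) ω ^ 2 := by
    ext ω
    rw [Finset.sum_range_succ, hX]
    ring
  have i1 : Integrable (fun ω => X ω ^ 2) P := (hL k).integrable_sq
  have i2 : Integrable (fun ω => 2 * (X ω * ξ (k + 1) ω)) P :=
    ((hL k).integrable_mul (hξ (k + 1))).const_mul 2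
  have i3 : Integrable (fun ω => ξ (k + 1) ω ^ 2) P := (hξ (k + 1)).integrable_sq
  have i12 : Integrable (fun ω => X ω ^ 2 + 2 * (X ω * ξ (k + 1) ω)) P := i1.add i2
  rw [hexp, integral_add i12.integrableOn i3.integrableOn, integral_add i1.integrableOn
    i2.integrableOn, integral_const_mul, hcross, mul_zero, add_zero]
  exact le_add_of_nonneg_right (integral_nonneg fun ω => sq_nonneg _)

/-- Doob's maximal inequality for the submartingale of squared partial sums, at level `a ^ 2`. -/
lemma measure_exists_le_abs_sum_le_of_stronglyMeasurable {ξ : ℕ → Ω → ℝ}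
    (hm : ∀ i, StronglyMeasurable (ξ i)) (hξ : ∀ i, MemLp (ξ i) 2 P) (hind : iIndepFun ξ P)
    (hmean : ∀ i, ∫ ω, ξ i ω ∂P = 0) (n : ℕ) {a : ℝ} (ha : 0 < a) :
    P {ω | ∃ k ≤ n, a ≤ |∑ i ∈ Finset.range (k + 1), ξ i ω|}
      ≤ ENNReal.ofReal ((∫ ω, (∑ i ∈ Finset.range (n + 1), ξ i ω) ^ 2 ∂P) / a ^ 2) := by
  have hL : MemLp (fun ω => ∑ i ∈ Finset.range (n + 1), ξ i ω) 2 P :=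
    memLp_finsetSum _ fun i _ => hξ i
  have h := maximal_ineq (submartingale_sum_sq hm hξ hind hmean)
    (fun k ω => sq_nonneg _) (ε := (a ^ 2).toNNReal) n
  have hset : {ω | ∃ k ≤ n, a ≤ |∑ i ∈ Finset.range (k + 1), ξ i ω|} ⊆
      {ω | ((a ^ 2).toNNReal : ℝ) ≤ (Finset.range (n + 1)).sup' Finset.nonempty_range_add_one
        fun k => (∑ i ∈ Finset.range (k + 1), ξ i ω) ^ 2} := by
    rintro ω ⟨k, hk, hak⟩
    rw [mem_ofPred_eq, Real.coe_toNNReal _ (sq_nonneg a), Finset.le_sup'_iff]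
    refine ⟨k, by simpa [Nat.lt_succ_iff] using hk, ?_⟩
    rw [← sq_abs (∑ i ∈ Finset.range (k + 1), ξ i ω)]
    gcongr
  rw [ENNReal.ofReal_div_of_pos (by positivity),
    ENNReal.le_div_iff_mul_le (Or.inl (by simpa using ha.ne')) (Or.inl ENNReal.ofReal_ne_top),
    mul_comm]
  refine (mul_le_mul_right (measure_mono hset) _).trans (h.trans ?_)
  exact ENNReal.ofReal_le_ofReal
    (setIntegral_le_integral hL.integrable_sq (ae_of_all _ fun ω => sq_nonneg _))

/-- **Kolmogorov's maximal inequality**. -/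
lemma measure_exists_le_abs_sum_le {ξ : ℕ → Ω → ℝ} (hξ : ∀ i, MemLp (ξ i) 2 P)
    (hind : iIndepFun ξ P) (hmean : ∀ i, ∫ ω, ξ i ω ∂P = 0) (n : ℕ) {a : ℝ} (ha : 0 < a) :
    P {ω | ∃ k ≤ n, a ≤ |∑ i ∈ Finset.range (k + 1), ξ i ω|}
      ≤ ENNReal.ofReal ((∫ ω, (∑ i ∈ Finset.range (n + 1), ξ i ω) ^ 2 ∂P) / a ^ 2) := by
  -- The natural filtration requires strongly measurable variables; all `ξ i` are modified off a
  -- common null set.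
  have hae (i : ℕ) : ξ i =ᵐ[P] (hξ i).1.mk (ξ i) := (hξ i).1.ae_eq_mk
  have hall : ∀ᵐ ω ∂P, ∀ i, ξ i ω = (hξ i).1.mk (ξ i) ω := ae_all_iff.2 hae
  have h := measure_exists_le_abs_sum_le_of_stronglyMeasurable
    (fun i => (hξ i).1.stronglyMeasurable_mk) (fun i => (memLp_congr_ae (hae i)).1 (hξ i))
    (hind.congr hae) (fun i => by rw [← hmean i]; exact integral_congr_ae (hae i).symm) n ha
  have h1 : P {ω | ∃ k ≤ n, a ≤ |∑ i ∈ Finset.range (k + 1), ξ i ω|}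
      = P {ω | ∃ k ≤ n, a ≤ |∑ i ∈ Finset.range (k + 1), (hξ i).1.mk (ξ i) ω|} := by
    refine measure_congr (eventuallyEq_set.2 ?_)
    filter_upwards [hall] with ω hω
    simp only [hω]
  have h2 : ∫ ω, (∑ i ∈ Finset.range (n + 1), ξ i ω) ^ 2 ∂P
      = ∫ ω, (∑ i ∈ Finset.range (n + 1), (hξ i).1.mk (ξ i) ω) ^ 2 ∂P := by
    refine integral_congr_ae ?_
    filter_upwards [hall] with ω hω
    simp only [hω]
  rw [h1, h2]
  exact h

end MaximalInequality

/-! ### Indefinite integrals of step functions -/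

section StepProcess

variable {Ω : Type*} {W : ℝ → Ω → ℝ}

/-- The indefinite integral of a step function. -/
def StepFunction.process (S : StepFunction) (W : ℝ → Ω → ℝ) (t : ℝ) (ω : Ω) : ℝ :=
  ∑ i, S.coeff i * (W (min (S.right i) t) ω - W (min (S.left i) t) ω)

lemma StepFunction.process_eq_integral_trunc (S : StepFunction) {t : ℝ} (ht : 0 ≤ t) :
    S.process W t = (S.trunc ht).integral W := rfl

lemma StepFunction.process_sub (S T : StepFunction) (t : ℝ) (ω : Ω) :
    (S.sub T).process W t ω = S.process W t ω - T.process W t ω := by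
  have h : (S.sub T).process W t ω
      = (S.sub T).integral (fun s ω => W (min s t) ω) ω := rfl
  rw [h, StepFunction.integral_sub]
  rfl

lemma StepFunction.process_zero (S : StepFunction) (ω : Ω) : S.process W 0 ω = 0 := by
  refine Finset.sum_eq_zero fun i _ => ?_
  rw [min_eq_right (S.left_mem i).1, min_eq_right (S.right_mem i).1, sub_self, mul_zero]

lemma StepFunction.continuousOn_process (S : StepFunction) {ω : Ω}
    (h : ContinuousOn (fun t => W t ω) (Icc 0 1)) :
    ContinuousOn (fun t => S.process W t ω) (Icc 0 1) := by
  have hmin {r : ℝ} (hr : r ∈ Icc (0 : ℝ) 1) :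
      ContinuousOn (fun t => W (min r t) ω) (Icc 0 1) :=
    h.comp (continuous_const.min continuous_id).continuousOn
      fun t ht => ⟨le_min hr.1 ht.1, (min_le_left _ _).trans hr.2⟩
  exact continuousOn_finsetSum _ fun i _ =>
    continuousOn_const.mul ((hmin (S.right_mem i)).sub (hmin (S.left_mem i)))

/-- No jump of `S` lies strictly between `a` and `b`, so `S` is constant on `(a, b]`; its value is
read at `b` because the intervals are closed on the right. -/
lemma StepFunction.process_sub_process (S : StepFunction) {a b : ℝ} (hab : a ≤ b)
    (hl : ∀ i, S.left i ≤ a ∨ b ≤ S.left i) (hr : ∀ i, S.right i ≤ a ∨ b ≤ S.right i) (ω : Ω) :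
    S.process W b ω - S.process W a ω = S.eval b * (W b ω - W a ω) := by
  rcases hab.eq_or_lt with rfl | hlt
  · simp
  rw [StepFunction.eval_eq_sum, process, process, ← Finset.sum_sub_distrib, Finset.sum_mul]
  refine Finset.sum_congr rfl fun i _ => ?_
  have hi := S.left_le_right i
  rcases hl i with h1 | h1 <;> rcases hr i with h2 | h2
  · rw [indicator_of_notMem fun h => (h.2.trans h2).not_gt hlt, min_eq_left h1, min_eq_left h2,
      min_eq_left (h1.trans hab), min_eq_left (h2.trans hab)]
    ring
  · rw [indicator_of_mem (show b ∈ Ioc _ _ from ⟨h1.trans_lt hlt, h2⟩), min_eq_left h1,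
      min_eq_right h2, min_eq_left (h1.trans hab), min_eq_right (hab.trans h2)]
    ring
  · exact absurd (h1.trans (hi.trans h2)) (not_le.2 hlt)
  · rw [indicator_of_notMem fun h => h.1.not_ge h1, min_eq_right h1, min_eq_right h2,
      min_eq_right (hab.trans h1), min_eq_right (hab.trans h2)]
    ring

end StepProcess

/-- The points of `T` in increasing order, preceded by `0` and padded with `1` forever: an infinite
sequence is produced because the maximal inequality is stated for variables indexed by `ℕ`. -/
lemma exists_monotone_grid (T : Finset unitInterval) :
    ∃ (t : ℕ → unitInterval) (n : ℕ), Monotone t ∧ t 0 = 0 ∧ ∀ x ∈ T, ∃ k ≤ n, t (k + 1) = x := by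
  classical
  let e := T.orderEmbOfFin rfl
  let t : ℕ → unitInterval := fun j => Nat.casesOn j 0
    fun k => if h : k < T.card then e ⟨k, h⟩ else 1
  have ht (k : ℕ) : t (k + 1) = if h : k < T.card then e ⟨k, h⟩ else 1 := rfl
  refine ⟨t, T.card, monotone_nat_of_le_succ fun k => ?_, rfl, fun x hx => ?_⟩
  · rcases k with _ | k
    · exact unitInterval.nonneg'
    · rw [ht, ht]
      by_cases h : k + 1 < T.card
      · rw [dif_pos h, dif_pos ((Nat.lt_succ_self k).trans h)]
        exact e.monotone (by simp)
      · rw [dif_neg h]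
        exact unitInterval.le_one'
  · have hx' : x ∈ Set.range e := by
      rw [Finset.range_orderEmbOfFin]
      exact hx
    obtain ⟨⟨k, hk⟩, rfl⟩ := hx'
    exact ⟨k, hk.le, by rw [ht, dif_pos hk]⟩

/-! ### The maximal inequality for paths of step integrals -/

section Maximal

variable {Ω : Type*} [MeasurableSpace Ω] {P : Measure Ω} {W : ℝ → Ω → ℝ}

lemma StepFunction.integral_process_sq_le (hW : IsBrownianOnUnit W P) (S : StepFunction) {t : ℝ}
    (ht : 0 ≤ t) : ∫ ω, S.process W t ω ^ 2 ∂P ≤ ∫ s in Icc (0 : ℝ) 1, S.eval s ^ 2 := by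
  rw [S.process_eq_integral_trunc ht, StepFunction.integral_integral_sq hW]
  refine integral_mono (S.trunc ht).memLp_eval.integrable_sq S.memLp_eval.integrable_sq
    fun s => ?_
  simp only [S.eval_trunc ht]
  by_cases h : s ∈ Ioc 0 t
  · rw [indicator_of_mem h]
  · rw [indicator_of_notMem h, zero_pow two_ne_zero]
    exact sq_nonneg _

variable [IsProbabilityMeasure P]

/-- Adding the jump points of `S` to the finite set `T` makes each increment of the process over a
grid cell a constant times an increment of `W`. The process on the grid is then a sum of independent
centred variables, to which Kolmogorov's inequality applies. -/
lemma StepFunction.measure_exists_mem_le_abs_process_le (hW : IsBrownianOnUnit W P)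
    (S : StepFunction) (T : Finset unitInterval) {a : ℝ} (ha : 0 < a) :
    P {ω | ∃ x ∈ T, a ≤ |S.process W x ω|}
      ≤ ENNReal.ofReal ((∫ s in Icc (0 : ℝ) 1, S.eval s ^ 2) / a ^ 2) := by
  classical
  obtain ⟨t, n, htm, ht0, htT⟩ := exists_monotone_grid
    (T ∪ (Finset.univ.image (fun i => (⟨S.left i, S.left_mem i⟩ : unitInterval)) ∪
      Finset.univ.image (fun i => (⟨S.right i, S.right_mem i⟩ : unitInterval))))
  have hgap {x : unitInterval} (hx : ∃ k ≤ n, t (k + 1) = x) (k : ℕ) :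
      (x : ℝ) ≤ t k ∨ (t (k + 1) : ℝ) ≤ x := by
    obtain ⟨m, -, rfl⟩ := hx
    rcases le_or_gt (m + 1) k with h | h
    · exact Or.inl (htm h)
    · exact Or.inr (htm h)
  have hl (k : ℕ) (i) : S.left i ≤ t k ∨ (t (k + 1) : ℝ) ≤ S.left i :=
    hgap (htT ⟨S.left i, S.left_mem i⟩ (by simp)) k
  have hr (k : ℕ) (i) : S.right i ≤ t k ∨ (t (k + 1) : ℝ) ≤ S.right i :=
    hgap (htT ⟨S.right i, S.right_mem i⟩ (by simp)) k
  set ξ : ℕ → Ω → ℝ := fun k ω => S.eval (t (k + 1)) * (W (t (k + 1)) ω - W (t k) ω) with hξ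
  have hsum (k : ℕ) (ω : Ω) : ∑ i ∈ Finset.range k, ξ i ω = S.process W (t k) ω := by
    have h1 (i : ℕ) : ξ i ω = S.process W (t (i + 1)) ω - S.process W (t i) ω :=
      (S.process_sub_process (htm (Nat.le_succ i)) (hl i) (hr i) ω).symm
    simp only [h1]
    rw [Finset.sum_range_sub (fun i => S.process W (t i) ω), ht0]
    simp [S.process_zero]
  have hincr : HasIndepIncrements (fun (t : unitInterval) => W t) P :=
    fun n t ht => hW.indep_increments n (fun i => t i) (fun i j hij => ht hij) fun i => (t i).2
  have hind : iIndepFun ξ P :=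
    (hincr.nat htm).comp (fun k x => S.eval (t (k + 1)) * x) fun k => measurable_const_mul _
  have hL (k : ℕ) : MemLp (ξ k) 2 P := (hW.memLp_increment (t k).2 (t (k + 1)).2).const_mul _
  have hmean (k : ℕ) : ∫ ω, ξ k ω ∂P = 0 := by
    rw [hξ, integral_const_mul,
      hW.integral_increment (t k).2.1 (htm (Nat.le_succ k)) (t (k + 1)).2.2, mul_zero]
  have hmax := measure_exists_le_abs_sum_le hL hind hmean n ha
  simp only [hsum] at hmax
  refine (measure_mono ?_).trans (hmax.trans (ENNReal.ofReal_le_ofReal ?_))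
  · rintro ω ⟨x, hx, hax⟩
    obtain ⟨k, hk, rfl⟩ := htT x (Finset.mem_union_left _ hx)
    exact ⟨k, hk, hax⟩
  · gcongr
    exact S.integral_process_sq_le hW (t (n + 1)).2.1

open Classical in
/-- The path of the indefinite integral of a step function as a continuous function, with value `0`
where `W` is discontinuous. -/
noncomputable def StepFunction.pathMap {Ω : Type*} (S : StepFunction) (W : ℝ → Ω → ℝ) (ω : Ω) :
    C(unitInterval, ℝ) :=
  if h : ContinuousOn (fun t => W t ω) (Icc 0 1) then
    ⟨fun t => S.process W t ω, continuousOn_iff_continuous_domRestrict.1 (S.continuousOn_process h)⟩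
  else 0

lemma StepFunction.pathMap_apply {Ω : Type*} {W : ℝ → Ω → ℝ} (S : StepFunction) {ω : Ω}
    (h : ContinuousOn (fun t => W t ω) (Icc 0 1)) (t : unitInterval) :
    S.pathMap W ω t = S.process W t ω := by
  rw [pathMap, dif_pos h]
  rfl

lemma StepFunction.pathMap_sub {Ω : Type*} {W : ℝ → Ω → ℝ} (S T : StepFunction) (ω : Ω) :
    (S.sub T).pathMap W ω = S.pathMap W ω - T.pathMap W ω := by
  by_cases h : ContinuousOn (fun t => W t ω) (Icc 0 1)
  · ext t
    rw [ContinuousMap.sub_apply, pathMap_apply _ h, pathMap_apply _ h, pathMap_apply _ h,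
      process_sub]
  · simp [pathMap, dif_neg h]

/-- The finite-set bound does not depend on the set, so it survives an increasing union over a
countable dense set. A continuous path whose norm exceeds `a` does so on a nonempty open set of
times, which meets the dense set. -/
lemma StepFunction.measure_lt_norm_pathMap_le (hW : IsBrownianOnUnit W P) (S : StepFunction)
    {a : ℝ} (ha : 0 < a) :
    P {ω | a < ‖S.pathMap W ω‖}
      ≤ ENNReal.ofReal ((∫ s in Icc (0 : ℝ) 1, S.eval s ^ 2) / a ^ 2) := by
  classical
  set q := TopologicalSpace.denseSeq unitInterval
  set E : ℕ → Set Ω := fun m => {ω | ∃ x ∈ (Finset.range m).image q, a ≤ |S.process W x ω|} with hE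
  have hmono : Monotone E := by
    rintro m n hmn ω ⟨x, hx, hax⟩
    exact ⟨x, Finset.image_subset_image (Finset.range_mono hmn) hx, hax⟩
  have hsub : {ω | a < ‖S.pathMap W ω‖} ⊆ ⋃ m, E m := by
    intro ω hω
    rw [mem_ofPred_eq] at hω
    have hc : ContinuousOn (fun t => W t ω) (Icc 0 1) := by
      by_contra h
      rw [pathMap, dif_neg h, norm_zero] at hω
      exact ha.not_gt hω
    have hne : {x : unitInterval | a < ‖S.pathMap W ω x‖}.Nonempty := by
      by_contra h
      rw [not_nonempty_iff_eq_empty, eq_empty_iff_forall_notMem] at h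
      exact hω.not_ge ((ContinuousMap.norm_le _ ha.le).2 fun x => not_lt.1 (h x))
    have hopen : IsOpen {x : unitInterval | a < ‖S.pathMap W ω x‖} :=
      isOpen_lt continuous_const (S.pathMap W ω).continuous.norm
    obtain ⟨k, hk⟩ := (TopologicalSpace.denseRange_denseSeq unitInterval).exists_mem_open hopen hne
    rw [mem_ofPred_eq, pathMap_apply _ hc, Real.norm_eq_abs] at hk
    exact mem_iUnion.2 ⟨k + 1, q k, Finset.mem_image_of_mem _ (by simp), hk.le⟩
  refine (measure_mono hsub).trans ?_
  rw [hmono.measure_iUnion]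
  exact iSup_le fun m => S.measure_exists_mem_le_abs_process_le hW _ ha

end Maximal

/-- Bernstein polynomials depend on finitely many values of a path and converge to it uniformly. -/
lemma aestronglyMeasurable_continuousMap {Ω : Type*} [MeasurableSpace Ω] {P : Measure Ω}
    {F : Ω → C(unitInterval, ℝ)} (h : ∀ t, AEStronglyMeasurable (fun ω => F ω t) P) :
    AEStronglyMeasurable F P := by
  refine aestronglyMeasurable_of_tendsto_ae atTop
    (f := fun n ω => bernsteinApproximation n (F ω)) (fun n => ?_)
    (ae_of_all _ fun ω => bernsteinApproximation_uniform (F ω))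
  refine Finset.aestronglyMeasurable_fun_sum _ fun k _ => ?_
  have hc : Continuous fun x : ℝ => bernstein n k • ContinuousMap.const unitInterval x :=
    continuous_const.mul ContinuousMap.continuous_const'
  exact hc.comp_aestronglyMeasurable (h _)

/-! ### A continuous version of the indefinite Wiener integral -/

section Path

variable {Ω : Type*} [MeasurableSpace Ω] {P : Measure Ω} {W : ℝ → Ω → ℝ}

lemma StepFunction.aestronglyMeasurable_pathMap (hW : IsBrownianOnUnit W P) (S : StepFunction) :
    AEStronglyMeasurable (S.pathMap W) P := by
  refine aestronglyMeasurable_continuousMap fun t => ?_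
  refine ((S.trunc t.2.1).memLp_integral hW).1.congr ?_
  filter_upwards [hW.continuous_paths] with ω hω
  rw [S.pathMap_apply hω]
  rfl

variable [IsProbabilityMeasure P]

/-- With `L²` increments at most `2 · 4⁻ᵏ` and threshold `2⁻ᵏ`, the maximal inequality gives
probabilities at most `4 · 4⁻ᵏ`. These are summable, so Borel–Cantelli leaves geometrically small
increments from some index on. -/
lemma ae_cauchySeq_pathMap (hW : IsBrownianOnUnit W P) {S : ℕ → StepFunction}
    (hS : ∀ k, eLpNorm (fun s => (S (k + 1)).eval s - (S k).eval s) 2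
      (volume.restrict (Icc (0 : ℝ) 1)) ≤ ENNReal.ofReal (2 * (1 / 4) ^ k)) :
    ∀ᵐ ω ∂P, CauchySeq fun k => (S k).pathMap W ω := by
  have hV (k : ℕ) : ∫ s in Icc (0 : ℝ) 1, ((S (k + 1)).sub (S k)).eval s ^ 2
      ≤ (2 * (1 / 4) ^ k) ^ 2 := by
    have h := hS k
    simp only [← StepFunction.eval_sub] at h
    rw [eLpNorm_two_eq_ofReal_sqrt (StepFunction.memLp_eval _),
      ENNReal.ofReal_le_ofReal_iff (by positivity)] at h
    exact (Real.sqrt_le_left (by positivity)).1 h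
  have hP (k : ℕ) : P {ω | (1 / 2) ^ k < ‖(S (k + 1)).pathMap W ω - (S k).pathMap W ω‖}
      ≤ ENNReal.ofReal (4 * (1 / 4) ^ k) := by
    simp only [← StepFunction.pathMap_sub]
    refine (StepFunction.measure_lt_norm_pathMap_le hW _ (by positivity)).trans
      (ENNReal.ofReal_le_ofReal ?_)
    rw [div_le_iff₀ (by positivity)]
    refine (hV k).trans (le_of_eq ?_)
    rw [mul_pow, mul_assoc, ← pow_mul, ← pow_mul, mul_comm k 2, pow_mul, pow_mul, ← mul_pow]
    norm_num
  have hsum : ∑' k, P {ω | (1 / 2) ^ k < ‖(S (k + 1)).pathMap W ω - (S k).pathMap W ω‖} ≠ ∞ := by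
    refine ne_top_of_le_ne_top ?_ (ENNReal.tsum_le_tsum hP)
    rw [← ENNReal.ofReal_tsum_of_nonneg (fun k => by positivity)
      ((summable_geometric_of_lt_one (by norm_num) (by norm_num)).mul_left 4)]
    exact ENNReal.ofReal_ne_top
  filter_upwards [ae_eventually_notMem hsum] with ω hω
  obtain ⟨N, hN⟩ := eventually_atTop.1 hω
  rw [← cauchySeq_shift N]
  refine cauchySeq_of_le_geometric (1 / 2) ((1 / 2) ^ N) (by norm_num) fun k => ?_
  have h := not_lt.1 (hN (k + N) (Nat.le_add_left N k))
  rw [dist_comm, dist_eq_norm, ← pow_add, add_comm N k, add_right_comm]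
  exact h

/-- The indefinite Wiener integral of a square integrable function has a version with continuous
paths. -/
lemma exists_continuous_wienerIntegral (hW : IsBrownianOnUnit W P) {δ : ℝ → ℝ}
    (hδ : MemLp δ 2 (volume.restrict (Icc (0 : ℝ) 1))) :
    ∃ M : Ω → C(unitInterval, ℝ), AEStronglyMeasurable M P ∧
      ∀ t : unitInterval, IsWienerIntegral W P ((Ioc 0 (t : ℝ)).indicator δ) (fun ω => M ω t) := by
  have hpos (k : ℕ) : ENNReal.ofReal ((1 / 4) ^ k) ≠ 0 := by
    rw [Ne, ENNReal.ofReal_eq_zero, not_le]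
    positivity
  choose S hS using fun k => exists_stepFunction_eLpNorm_sub_le hδ (hpos k)
  have hdiff (k : ℕ) : eLpNorm (fun s => (S (k + 1)).eval s - (S k).eval s) 2
      (volume.restrict (Icc (0 : ℝ) 1)) ≤ ENNReal.ofReal (2 * (1 / 4) ^ k) := by
    refine (eLpNorm_sub_le_add (S (k + 1)).memLp_eval.1 hδ.1 (S k).memLp_eval.1).trans ?_
    rw [eLpNorm_fun_sub_comm, two_mul, ENNReal.ofReal_add (by positivity) (by positivity)]
    refine add_le_add ((hS (k + 1)).trans (ENNReal.ofReal_le_ofReal ?_)) (hS k)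
    exact pow_le_pow_of_le_one (by norm_num) (by norm_num) (Nat.le_succ k)
  have hlim : Tendsto (fun k => eLpNorm (fun s => δ s - (S k).eval s) 2
      (volume.restrict (Icc (0 : ℝ) 1))) atTop (𝓝 0) := by
    have h0 : Tendsto (fun k : ℕ => ENNReal.ofReal ((1 / 4) ^ k)) atTop (𝓝 0) := by
      rw [← ENNReal.ofReal_zero]
      exact ENNReal.tendsto_ofReal (tendsto_pow_atTop_nhds_zero_of_lt_one (by norm_num)
        (by norm_num))
    exact tendsto_of_tendsto_of_tendsto_of_le_of_le tendsto_const_nhds h0 (fun _ => zero_le) hS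
  have hconv : ∀ᵐ ω ∂P, Tendsto (fun k => (S k).pathMap W ω) atTop
      (𝓝 (limUnder atTop fun k => (S k).pathMap W ω)) := by
    filter_upwards [ae_cauchySeq_pathMap hW hdiff] with ω hω
    exact tendsto_nhds_limUnder (cauchySeq_tendsto_of_complete hω)
  refine ⟨fun ω => limUnder atTop fun k => (S k).pathMap W ω,
    aestronglyMeasurable_of_tendsto_ae atTop (fun k => (S k).aestronglyMeasurable_pathMap hW) hconv,
    fun t => ?_⟩
  refine IsWienerIntegral.of_tendsto hW (G := fun k => ((S k).trunc t.2.1).eval)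
    (Ξ := fun k => ((S k).trunc t.2.1).integral W) (hδ.1.indicator measurableSet_Ioc)
    (fun k => (StepFunction.memLp_eval _).1) (fun k => StepFunction.isWienerIntegral hW _) ?_ ?_
  -- Truncating at time `t` can only decrease the pointwise error, so one sequence of step functions
  -- serves every `t`.
  · refine tendsto_of_tendsto_of_tendsto_of_le_of_le tendsto_const_nhds hlim (fun _ => zero_le)
      fun k => eLpNorm_mono fun s => ?_
    rw [StepFunction.eval_trunc]
    by_cases h : s ∈ Ioc 0 (t : ℝ)
    · rw [indicator_of_mem h, indicator_of_mem h]
    · rw [indicator_of_notMem h, indicator_of_notMem h]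
      simp
  · filter_upwards [hconv, hW.continuous_paths] with ω h1 h2
    refine (((continuous_eval_const t).tendsto _).comp h1).congr fun k => ?_
    exact (S k).pathMap_apply h2 t

end Path

/-! ### Riemann sums -/

section RiemannSum

lemma tendsto_riemann_sum {g : ℝ → ℝ} (hg : Continuous g) {t : ℝ} (ht : 0 ≤ t) :
    Tendsto (fun n : ℕ => t / (n + 1) *
      ∑ j ∈ Finset.range (n + 1), g (t / (n + 1) * ((j : ℝ) + 1))) atTop
      (𝓝 (∫ u in (0 : ℝ)..t, g u)) := by
  rw [Metric.tendsto_atTop]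
  intro ε hε
  have huc := isCompact_Icc.uniformContinuousOn_of_continuous (hg.continuousOn (s := Icc (0 : ℝ) t))
  -- With this tolerance the total error is `(ε / 2) * (t / (t + 1)) < ε`; the `+ 1` covers `t = 0`.
  obtain ⟨d, hd, hgd⟩ := Metric.uniformContinuousOn_iff_le.1 huc (ε / (2 * (t + 1)))
    (by positivity)
  obtain ⟨N, hN⟩ := exists_nat_gt (t / d)
  refine ⟨N, fun n hn => ?_⟩
  have hn1 : (0 : ℝ) < n + 1 := by positivity
  set h : ℝ := t / (n + 1) with hh
  have hhd : h ≤ d := by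
    rw [hh, div_le_iff₀ hn1, ← div_le_iff₀' hd]
    have : (N : ℝ) ≤ n := by exact_mod_cast hn
    linarith
  have hh0 : 0 ≤ h := by positivity
  have hht : h * (n + 1) = t := div_mul_cancel₀ _ hn1.ne'
  have hsplit : ∫ u in (0 : ℝ)..t, g u
      = ∑ j ∈ Finset.range (n + 1), ∫ u in (h * (j : ℝ))..(h * ((j : ℝ) + 1)), g u := by
    have := intervalIntegral.sum_integral_adjacent_intervals (f := g) (μ := volume)
      (a := fun j : ℕ => h * (j : ℝ)) (n := n + 1) fun k _ => hg.intervalIntegrable _ _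
    simp only [Nat.cast_add, Nat.cast_one, hht, Nat.cast_zero, mul_zero] at this
    exact this.symm
  have hterm : ∀ j ∈ Finset.range (n + 1),
      ‖h * g (h * ((j : ℝ) + 1)) - ∫ u in (h * (j : ℝ))..(h * ((j : ℝ) + 1)), g u‖
        ≤ ε / (2 * (t + 1)) * h := by
    intro j hj
    have hj1 : (j : ℝ) + 1 ≤ n + 1 := by
      exact_mod_cast Finset.mem_range.1 hj
    have hle : h * (j : ℝ) ≤ h * ((j : ℝ) + 1) := by nlinarith
    have hc : h * g (h * ((j : ℝ) + 1))
        = ∫ _ in (h * (j : ℝ))..(h * ((j : ℝ) + 1)), g (h * ((j : ℝ) + 1)) := by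
      rw [intervalIntegral.integral_const, smul_eq_mul]
      ring
    rw [hc, ← intervalIntegral.integral_sub intervalIntegrable_const (hg.intervalIntegrable _ _)]
    refine (intervalIntegral.norm_integral_le_of_norm_le_const (C := ε / (2 * (t + 1)))
      fun u hu => ?_).trans_eq ?_
    · rw [uIoc_of_le hle] at hu
      have hj0 : 0 ≤ h * (j : ℝ) := by positivity
      have hjt : h * ((j : ℝ) + 1) ≤ t := by
        rw [← hht]
        gcongr
      refine hgd _ ⟨hj0.trans hle, hjt⟩ _ ⟨hj0.trans hu.1.le, hu.2.trans hjt⟩ ?_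
      rw [Real.dist_eq, abs_of_nonneg (sub_nonneg.2 hu.2)]
      linarith [hu.1]
    · rw [← mul_sub, add_sub_cancel_left, mul_one, abs_of_nonneg hh0]
  rw [dist_eq_norm, hsplit, Finset.mul_sum, ← Finset.sum_sub_distrib]
  refine (norm_sum_le_of_le _ hterm).trans_lt ?_
  rw [Finset.sum_const, Finset.card_range, nsmul_eq_mul]
  push_cast
  have : (n + 1 : ℝ) * (ε / (2 * (t + 1)) * h) = ε / 2 * (t / (t + 1)) := by
    rw [← hht]
    field_simp
  rw [this]
  have h1 : t / (t + 1) ≤ 1 := div_le_one_of_le₀ (by linarith) (by positivity)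
  nlinarith

/-- The right-endpoint Riemann sums of `u ↦ 1_{s ≤ u}` approximate its integral over `[0, n h]`
with an error of at most the mesh `h`. -/
lemma abs_riemann_sum_indicator_sub_le {h s : ℝ} (hh : 0 ≤ h) (hs : 0 < s) (n : ℕ) :
    |h * ∑ j ∈ Finset.range n, (if s ≤ h * ((j : ℝ) + 1) then (1 : ℝ) else 0)
      - max (h * n - s) 0| ≤ h := by
  -- The error on one cell is nonnegative and at most the increment of `u ↦ h 1_{s ≤ u}` across the
  -- cell. Only the cell containing the jump contributes, and the increments telescope to at most
  -- `h`.
  have key (j : ℕ) : 0 ≤ h * (if s ≤ h * ((j : ℝ) + 1) then (1 : ℝ) else 0)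
        - (max (h * ((j : ℝ) + 1) - s) 0 - max (h * j - s) 0) ∧
      h * (if s ≤ h * ((j : ℝ) + 1) then (1 : ℝ) else 0)
        - (max (h * ((j : ℝ) + 1) - s) 0 - max (h * j - s) 0)
      ≤ h * (if s ≤ h * ((j : ℝ) + 1) then (1 : ℝ) else 0)
        - h * (if s ≤ h * (j : ℝ) then (1 : ℝ) else 0) := by
    have hle : h * (j : ℝ) ≤ h * ((j : ℝ) + 1) := by nlinarith
    have heq : h * ((j : ℝ) + 1) = h * j + h := by ring
    by_cases h1 : s ≤ h * ((j : ℝ) + 1)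
    · by_cases h2 : s ≤ h * (j : ℝ)
      · rw [if_pos h1, if_pos h2, max_eq_left (by linarith), max_eq_left (by linarith)]
        constructor <;> linarith
      · rw [if_pos h1, if_neg h2, max_eq_left (by linarith), max_eq_right (by linarith)]
        constructor <;> linarith
    · rw [if_neg h1, if_neg fun h2 => h1 (h2.trans hle), max_eq_right (by linarith),
        max_eq_right (by linarith)]
      constructor <;> linarith
  have t1 : ∑ j ∈ Finset.range n, (max (h * ((j : ℝ) + 1) - s) 0 - max (h * j - s) 0)
      = max (h * n - s) 0 := by
    have := Finset.sum_range_sub (fun j : ℕ => max (h * (j : ℝ) - s) 0) n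
    simp only [Nat.cast_add, Nat.cast_one, Nat.cast_zero, mul_zero, zero_sub] at this
    rw [this, max_eq_right (by linarith : -s ≤ 0), sub_zero]
  have t2 : ∑ j ∈ Finset.range n, (h * (if s ≤ h * ((j : ℝ) + 1) then (1 : ℝ) else 0)
        - h * (if s ≤ h * (j : ℝ) then (1 : ℝ) else 0)) ≤ h := by
    have := Finset.sum_range_sub (fun j : ℕ => h * (if s ≤ h * (j : ℝ) then (1 : ℝ) else 0)) n
    simp only [Nat.cast_add, Nat.cast_one, Nat.cast_zero, mul_zero] at this
    rw [this, if_neg (not_le.2 hs)]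
    split_ifs <;> linarith
  rw [← t1, Finset.mul_sum, ← Finset.sum_sub_distrib,
    abs_of_nonneg (Finset.sum_nonneg fun j _ => (key j).1)]
  exact (Finset.sum_le_sum fun j _ => (key j).2).trans t2

end RiemannSum

/-! ### Deterministic and stochastic Fubini theorems -/

section StochasticFubini

/-- The extension of a continuous function on `[0,1]` to `ℝ` that is constant on both sides. -/
noncomputable def ext (y : C(unitInterval, ℝ)) : ℝ → ℝ := IccExtend zero_le_one y

lemma continuous_ext (y : C(unitInterval, ℝ)) : Continuous (ext y) := y.continuous.Icc_extend'

lemma ext_of_mem (y : C(unitInterval, ℝ)) {t : ℝ} (ht : t ∈ Icc (0 : ℝ) 1) : ext y t = y ⟨t, ht⟩ :=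
  IccExtend_of_mem zero_le_one y ht

lemma abs_ext_le (y : C(unitInterval, ℝ)) (t : ℝ) : |ext y t| ≤ ‖y‖ := y.norm_coe_le_norm _

lemma ext_sub (y z : C(unitInterval, ℝ)) (t : ℝ) : ext (y - z) t = ext y t - ext z t := rfl

variable {Ω : Type*} [MeasurableSpace Ω] {P : Measure Ω} {W : ℝ → Ω → ℝ}

/-- A stochastic Fubini theorem: `∫_0^t ∫_0^u δ dW du = ∫_0^1 (t - s)⁺ δ(s) dW_s`. -/
lemma isWienerIntegral_integral_path (hW : IsBrownianOnUnit W P) {δ : ℝ → ℝ}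
    (hδ : MemLp δ 2 (volume.restrict (Icc (0 : ℝ) 1))) {M : Ω → C(unitInterval, ℝ)}
    (hM : ∀ t : unitInterval,
      IsWienerIntegral W P ((Ioc 0 (t : ℝ)).indicator δ) (fun ω => M ω t))
    {t : ℝ} (ht : t ∈ Icc (0 : ℝ) 1) :
    IsWienerIntegral W P (fun s => max (t - s) 0 * δ s)
      (fun ω => ∫ u in (0 : ℝ)..t, ext (M ω) u) := by
  have hmem (n : ℕ) {j : ℕ} (hj : j ∈ Finset.range (n + 1)) :
      t / (n + 1) * ((j : ℝ) + 1) ∈ Icc (0 : ℝ) 1 := by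
    have hj1 : (j : ℝ) + 1 ≤ n + 1 := by exact_mod_cast Finset.mem_range.1 hj
    refine ⟨mul_nonneg (div_nonneg ht.1 (by positivity)) (by positivity), ?_⟩
    rw [div_mul_eq_mul_div]
    refine div_le_one_of_le₀ ?_ (by positivity)
    nlinarith [ht.1, ht.2]
  have hind (u : ℝ) : AEStronglyMeasurable ((Ioc 0 u).indicator δ)
      (volume.restrict (Icc (0 : ℝ) 1)) := hδ.1.indicator measurableSet_Ioc
  -- Riemann sums in `u` are finite combinations of the variables `M_u`, so linearity makes them
  -- Wiener integrals. They converge on every path by continuity, and their integrands converge in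
  -- `L²`.
  refine IsWienerIntegral.of_tendsto hW
    (G := fun n s => t / (n + 1) * ∑ j ∈ Finset.range (n + 1),
      (Ioc 0 (t / (n + 1) * ((j : ℝ) + 1))).indicator δ s)
    (Ξ := fun n ω => t / (n + 1) * ∑ j ∈ Finset.range (n + 1),
      ext (M ω) (t / (n + 1) * ((j : ℝ) + 1))) ?_ (fun n => ?_) (fun n => ?_) ?_ ?_
  · exact ((continuous_const.sub continuous_id).max continuous_const).aestronglyMeasurable.mul hδ.1
  · exact (Finset.aestronglyMeasurable_fun_sum _ fun j _ => hind _).const_mul _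
  · refine (IsWienerIntegral.sum hW _ (fun j _ => hind _) fun j hj => ?_).const_smul _
    have := hM ⟨_, hmem n hj⟩
    simpa only [ext_of_mem _ (hmem n hj)] using this
  · have h0 : Tendsto (fun n : ℕ => ENNReal.ofReal (t / (n + 1)) *
        eLpNorm δ 2 (volume.restrict (Icc (0 : ℝ) 1))) atTop (𝓝 0) := by
      have h1 : Tendsto (fun n : ℕ => t / ((n : ℝ) + 1)) atTop (𝓝 0) := by
        have := (tendsto_one_div_add_atTop_nhds_zero_nat (𝕜 := ℝ)).const_mul t
        simpa [div_eq_mul_inv] using this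
      have h2 := ENNReal.Tendsto.mul_const (ENNReal.tendsto_ofReal h1)
        (b := eLpNorm δ 2 (volume.restrict (Icc (0 : ℝ) 1))) (Or.inr hδ.2.ne)
      simpa using h2
    refine tendsto_of_tendsto_of_tendsto_of_le_of_le tendsto_const_nhds h0 (fun _ => zero_le)
      fun n => ?_
    have hh0 : 0 ≤ t / ((n : ℝ) + 1) := div_nonneg ht.1 (by positivity)
    have hne : ∀ᵐ s ∂(volume.restrict (Icc (0 : ℝ) 1)), s ≠ 0 :=
      ae_restrict_of_ae (Measure.ae_ne _ 0)
    -- The integrands differ by at most the mesh times `|δ|`, almost everywhere.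
    have hle := eLpNorm_le_mul_eLpNorm_of_ae_le_mul (μ := volume.restrict (Icc (0 : ℝ) 1))
      (f := fun s => max (t - s) 0 * δ s - t / (n + 1) * ∑ j ∈ Finset.range (n + 1),
        (Ioc 0 (t / (n + 1) * ((j : ℝ) + 1))).indicator δ s) (g := δ) (c := t / (n + 1)) ?_ 2
    · exact hle
    filter_upwards [hne, ae_restrict_mem measurableSet_Icc] with s hs0 hs
    have hs1 : 0 < s := hs.1.lt_of_ne' hs0
    have hb := abs_riemann_sum_indicator_sub_le hh0 hs1 (n + 1)
    have hcast : t / ((n : ℝ) + 1) * ((n + 1 : ℕ) : ℝ) = t := by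
      push_cast
      exact div_mul_cancel₀ _ (by positivity)
    rw [hcast] at hb
    have hsum : ∑ j ∈ Finset.range (n + 1),
        (Ioc 0 (t / (n + 1) * ((j : ℝ) + 1))).indicator δ s
        = (∑ j ∈ Finset.range (n + 1),
          (if s ≤ t / (n + 1) * ((j : ℝ) + 1) then (1 : ℝ) else 0)) * δ s := by
      rw [Finset.sum_mul]
      refine Finset.sum_congr rfl fun j _ => ?_
      by_cases h : s ≤ t / (n + 1) * ((j : ℝ) + 1)
      · rw [if_pos h, one_mul]
        exact indicator_of_mem (show s ∈ Ioc _ _ from ⟨hs1, h⟩) _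
      · rw [if_neg h, zero_mul]
        exact indicator_of_notMem (fun h' => h h'.2) _
    rw [hsum, ← mul_assoc, ← sub_mul, norm_mul]
    refine mul_le_mul_of_nonneg_right ?_ (norm_nonneg _)
    rw [Real.norm_eq_abs, abs_sub_comm]
    exact hb
  · exact ae_of_all _ fun ω => tendsto_riemann_sum (continuous_ext (M ω)) ht.1

/-- The Green function as a double-integration kernel minus the linear term that restores the
boundary value at `1`. Both Fubini theorems are thereby reduced to the kernel `(t - s)⁺`. -/
lemma upsilon_eq {t s : ℝ} (hs : s ≤ 1) :
    upsilon t s = max (t - s) 0 - t * max (1 - s) 0 := by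
  rw [upsilon, max_eq_left (sub_nonneg.2 hs)]
  rcases le_total t s with h | h
  · rw [min_eq_left h, max_eq_right h, max_eq_right (sub_nonpos.2 h)]
    ring
  · rw [min_eq_right h, max_eq_left h, max_eq_left (sub_nonneg.2 h)]
    ring

lemma isWienerIntegral_bridge (hW : IsBrownianOnUnit W P) {δ : ℝ → ℝ}
    (hδ : MemLp δ 2 (volume.restrict (Icc (0 : ℝ) 1))) {M : Ω → C(unitInterval, ℝ)}
    (hM : ∀ t : unitInterval,
      IsWienerIntegral W P ((Ioc 0 (t : ℝ)).indicator δ) (fun ω => M ω t))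
    {t : ℝ} (ht : t ∈ Icc (0 : ℝ) 1) :
    IsWienerIntegral W P (fun s => upsilon t s * δ s)
      (fun ω => (∫ u in (0 : ℝ)..t, ext (M ω) u) - t * ∫ u in (0 : ℝ)..1, ext (M ω) u) := by
  have hm (r : ℝ) : AEStronglyMeasurable (fun s => max (r - s) 0 * δ s)
      (volume.restrict (Icc (0 : ℝ) 1)) :=
    ((continuous_const.sub continuous_id).max continuous_const).aestronglyMeasurable.mul hδ.1
  refine ((isWienerIntegral_integral_path hW hδ hM ht).sub hW (hm t) ((hm 1).const_mul t)
    ((isWienerIntegral_integral_path hW hδ hM ⟨zero_le_one, le_rfl⟩).const_smul t)).congr ?_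
  filter_upwards [ae_restrict_mem measurableSet_Icc] with s hs
  rw [upsilon_eq hs.2]
  ring

/-- The deterministic counterpart of `isWienerIntegral_integral_path`. -/
lemma integral_integral_eq_integral_posPart_mul {h : ℝ → ℝ}
    (hh : IntervalIntegrable h volume 0 1) {t : ℝ} (ht : t ∈ Icc (0 : ℝ) 1) :
    ∫ u in (0 : ℝ)..t, ∫ s in (0 : ℝ)..u, h s = ∫ s in (0 : ℝ)..1, max (t - s) 0 * h s := by
  rw [intervalIntegrable_iff_integrableOn_Ioc_of_le zero_le_one] at hh
  -- Fubini on the triangle `s ≤ u ≤ t`, encoded by an indicator on a rectangle.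
  have hint : Integrable (Function.uncurry fun u s : ℝ =>
      {z : ℝ × ℝ | z.2 ≤ z.1}.indicator (fun z => h z.2) (u, s))
      ((volume.restrict (Ioc 0 t)).prod (volume.restrict (Ioc 0 1))) :=
    (Integrable.comp_snd hh _).indicator (measurableSet_le measurable_snd measurable_fst)
  have hswap := integral_integral_swap hint
  have h1 : ∫ u in (0 : ℝ)..t, ∫ s in (0 : ℝ)..u, h s = ∫ u in Ioc 0 t, ∫ s in Ioc (0 : ℝ) 1,
      {z : ℝ × ℝ | z.2 ≤ z.1}.indicator (fun z => h z.2) (u, s) := by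
    rw [intervalIntegral.integral_of_le ht.1]
    refine setIntegral_congr_fun measurableSet_Ioc fun u hu => ?_
    have hset : Ioc (0 : ℝ) u = Iic u ∩ Ioc 0 1 := by
      ext s
      simp only [mem_Ioc, mem_inter_iff, mem_Iic]
      constructor
      · exact fun hs => ⟨hs.2, hs.1, hs.2.trans (hu.2.trans ht.2)⟩
      · exact fun hs => ⟨hs.2.1, hs.1⟩
    rw [intervalIntegral.integral_of_le hu.1.le, hset, ← Measure.restrict_restrict measurableSet_Iic,
      ← integral_indicator measurableSet_Iic]
    rfl
  have h2 : ∫ s in (0 : ℝ)..1, max (t - s) 0 * h s = ∫ s in Ioc (0 : ℝ) 1, ∫ u in Ioc 0 t,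
      {z : ℝ × ℝ | z.2 ≤ z.1}.indicator (fun z => h z.2) (u, s) := by
    rw [intervalIntegral.integral_of_le zero_le_one]
    refine setIntegral_congr_fun measurableSet_Ioc fun s hs => ?_
    have hset : Ici s ∩ Ioc 0 t = Icc s t := by
      ext u
      simp only [mem_Ioc, mem_inter_iff, mem_Ici, mem_Icc]
      constructor
      · exact fun hu => ⟨hu.1, hu.2.2⟩
      · exact fun hu => ⟨hu.1, hs.1.trans_le hu.1, hu.2⟩
    have hi : (fun u => {z : ℝ × ℝ | z.2 ≤ z.1}.indicator (fun z => h z.2) (u, s))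
        = (Ici s).indicator (fun _ => h s) := rfl
    rw [hi, integral_indicator measurableSet_Ici, Measure.restrict_restrict measurableSet_Ici, hset]
    simp
  rw [h1, h2, hswap]

lemma integral_upsilon_mul {h : ℝ → ℝ} (hh : IntervalIntegrable h volume 0 1) {t : ℝ}
    (ht : t ∈ Icc (0 : ℝ) 1) :
    ∫ s in (0 : ℝ)..1, upsilon t s * h s
      = (∫ u in (0 : ℝ)..t, ∫ s in (0 : ℝ)..u, h s)
        - t * ∫ u in (0 : ℝ)..1, ∫ s in (0 : ℝ)..u, h s := by
  have hc (r : ℝ) : IntervalIntegrable (fun s => max (r - s) 0 * h s) volume 0 1 :=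
    hh.continuousOn_mul ((continuous_const.sub continuous_id).max continuous_const).continuousOn
  rw [integral_integral_eq_integral_posPart_mul hh ht,
    integral_integral_eq_integral_posPart_mul hh ⟨zero_le_one, le_rfl⟩,
    ← intervalIntegral.integral_const_mul, ← intervalIntegral.integral_sub (hc t)
      ((hc 1).const_mul t)]
  refine intervalIntegral.integral_congr fun s hs => ?_
  rw [uIcc_of_le zero_le_one] at hs
  simp only [upsilon_eq hs.2]
  ring

end StochasticFubini

/-! ### The linear Dirichlet problem on `C([0,1])` -/

section Bridge

/-- The function `t ↦ ∫_0^t H - t ∫_0^1 H`, the solution of `ẋ = H + const`, `x(0) = x(1) = 0`. -/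
noncomputable def bridgeFun (H : C(unitInterval, ℝ)) (t : ℝ) : ℝ :=
  (∫ u in (0 : ℝ)..t, ext H u) - t * ∫ u in (0 : ℝ)..1, ext H u

lemma hasDerivAt_bridgeFun (H : C(unitInterval, ℝ)) (t : ℝ) :
    HasDerivAt (bridgeFun H) (ext H t - ∫ u in (0 : ℝ)..1, ext H u) t := by
  have h1 := (continuous_ext H).integral_hasStrictDerivAt 0 t
  have h2 := h1.hasDerivAt.sub ((hasDerivAt_id t).mul_const (∫ u in (0 : ℝ)..1, ext H u))
  rw [one_mul] at h2
  exact h2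

lemma contDiff_bridgeFun (H : C(unitInterval, ℝ)) : ContDiff ℝ 1 (bridgeFun H) := by
  rw [contDiff_one_iff_deriv]
  refine ⟨fun t => (hasDerivAt_bridgeFun H t).differentiableAt, ?_⟩
  have : deriv (bridgeFun H) = fun t => ext H t - ∫ u in (0 : ℝ)..1, ext H u :=
    funext fun t => (hasDerivAt_bridgeFun H t).deriv
  rw [this]
  exact (continuous_ext H).sub continuous_const

lemma bridgeFun_zero (H : C(unitInterval, ℝ)) : bridgeFun H 0 = 0 := by simp [bridgeFun]

lemma bridgeFun_one (H : C(unitInterval, ℝ)) : bridgeFun H 1 = 0 := by simp [bridgeFun]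

/-- `bridgeFun` as an operator on `C([0,1])`. -/
noncomputable def bridge (H : C(unitInterval, ℝ)) : C(unitInterval, ℝ) :=
  ⟨fun t => bridgeFun H t, (contDiff_bridgeFun H).continuous.comp continuous_subtype_val⟩

lemma bridge_apply (H : C(unitInterval, ℝ)) (t : unitInterval) : bridge H t = bridgeFun H t := rfl

lemma bridge_sub (H G : C(unitInterval, ℝ)) : bridge (H - G) = bridge H - bridge G := by
  ext t
  have h (r : ℝ) : ∫ u in (0 : ℝ)..r, ext (H - G) u
      = (∫ u in (0 : ℝ)..r, ext H u) - ∫ u in (0 : ℝ)..r, ext G u :=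
    intervalIntegral.integral_sub ((continuous_ext H).intervalIntegrable _ _)
      ((continuous_ext G).intervalIntegrable _ _)
  rw [ContinuousMap.sub_apply, bridge_apply, bridge_apply, bridge_apply]
  simp only [bridgeFun, h]
  ring

lemma norm_bridge_le (H : C(unitInterval, ℝ)) : ‖bridge H‖ ≤ 2 * ‖H‖ := by
  rw [ContinuousMap.norm_le _ (by positivity)]
  intro t
  have h (r : unitInterval) : |∫ u in (0 : ℝ)..r, ext H u| ≤ ‖H‖ := by
    rw [← Real.norm_eq_abs]
    refine (intervalIntegral.norm_integral_le_of_norm_le_const (C := ‖H‖)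
      fun u _ => abs_ext_le H u).trans ?_
    rw [sub_zero, abs_of_nonneg r.2.1]
    exact mul_le_of_le_one_right (norm_nonneg _) r.2.2
  have h1 : |∫ u in (0 : ℝ)..1, ext H u| ≤ ‖H‖ := h 1
  rw [bridge_apply, bridgeFun, two_mul]
  refine (abs_sub _ _).trans (add_le_add (h t) ?_)
  rw [abs_mul, abs_of_nonneg t.2.1]
  exact (mul_le_of_le_one_left (abs_nonneg _) t.2.2).trans h1

open Classical in
/-- The primitive of an integrable function as an element of `C([0,1])`. -/
noncomputable def primitive (h : ℝ → ℝ) : C(unitInterval, ℝ) :=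
  if hh : IntervalIntegrable h volume 0 1 then
    ⟨fun t => ∫ s in (0 : ℝ)..t, h s, by
      have := intervalIntegral.continuousOn_primitive_interval (μ := volume) (a := 0) (b := 1)
        (f := h) (by
          rwa [uIcc_of_le zero_le_one, ← intervalIntegrable_iff_integrableOn_Icc_of_le zero_le_one])
      rw [uIcc_of_le zero_le_one] at this
      exact continuousOn_iff_continuous_domRestrict.1 this⟩
  else 0

lemma primitive_apply {h : ℝ → ℝ} (hh : IntervalIntegrable h volume 0 1) (t : unitInterval) :
    primitive h t = ∫ s in (0 : ℝ)..t, h s := by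
  rw [primitive, dif_pos hh]
  rfl

lemma intervalIntegrable_of_mem {h : ℝ → ℝ} (hh : IntervalIntegrable h volume 0 1)
    (t : unitInterval) : IntervalIntegrable h volume 0 t :=
  hh.mono_set (by
    rw [uIcc_of_le zero_le_one, uIcc_of_le t.2.1]
    exact Icc_subset_Icc_right t.2.2)

lemma norm_primitive_sub_le {h k : ℝ → ℝ} (hh : IntervalIntegrable h volume 0 1)
    (hk : IntervalIntegrable k volume 0 1) {c : ℝ}
    (hc : ∀ s ∈ Icc (0 : ℝ) 1, |h s - k s| ≤ c) : ‖primitive h - primitive k‖ ≤ c := by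
  have hc0 : 0 ≤ c := (abs_nonneg _).trans (hc 0 ⟨le_rfl, zero_le_one⟩)
  rw [ContinuousMap.norm_le _ hc0]
  intro t
  rw [ContinuousMap.sub_apply, primitive_apply hh, primitive_apply hk,
    ← intervalIntegral.integral_sub (intervalIntegrable_of_mem hh t)
      (intervalIntegrable_of_mem hk t)]
  refine (intervalIntegral.norm_integral_le_of_norm_le_const (C := c) fun u hu => ?_).trans ?_
  · rw [uIoc_of_le t.2.1] at hu
    exact hc u ⟨hu.1.le, hu.2.trans t.2.2⟩
  · rw [sub_zero, abs_of_nonneg t.2.1]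
    exact mul_le_of_le_one_right hc0 t.2.2

end Bridge

/-! ### The nonlinear problem as a fixed-point equation -/

section FixedPoint

/-- The map whose fixed points are the solutions of the integrated Dirichlet problem with
right-hand side `F`, driving path `m` and squared noise level `e`. -/
noncomputable def solutionMap (F : ℝ → ℝ → ℝ) (e : ℝ) (m y : C(unitInterval, ℝ)) :
    C(unitInterval, ℝ) :=
  e • bridge (primitive (fun s => F s (ext y s)) + m)

variable {F : ℝ → ℝ → ℝ} {L e : ℝ}

lemma norm_primitive_comp_sub_le
    (hF : ∀ y : C(unitInterval, ℝ), IntervalIntegrable (fun s => F s (ext y s)) volume 0 1)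
    (hL0 : 0 ≤ L) (hL : ∀ t ∈ Icc (0 : ℝ) 1, ∀ x x', |F t x - F t x'| ≤ L * |x - x'|)
    (y z : C(unitInterval, ℝ)) :
    ‖primitive (fun s => F s (ext y s)) - primitive (fun s => F s (ext z s))‖ ≤ L * ‖y - z‖ := by
  refine norm_primitive_sub_le (hF y) (hF z) fun s hs => (hL s hs _ _).trans ?_
  gcongr
  rw [← ext_sub]
  exact abs_ext_le _ _

/-- Dependence on `y` gives the contraction; dependence on `m` gives continuity of the fixed point
in the driving path. -/
lemma norm_solutionMap_sub_le
    (hF : ∀ y : C(unitInterval, ℝ), IntervalIntegrable (fun s => F s (ext y s)) volume 0 1)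
    (hL0 : 0 ≤ L) (hL : ∀ t ∈ Icc (0 : ℝ) 1, ∀ x x', |F t x - F t x'| ≤ L * |x - x'|)
    (he : 0 ≤ e) (m m' y z : C(unitInterval, ℝ)) :
    ‖solutionMap F e m y - solutionMap F e m' z‖ ≤ 2 * e * (L * ‖y - z‖ + ‖m - m'‖) := by
  rw [solutionMap, solutionMap, ← smul_sub, norm_smul, Real.norm_of_nonneg he, ← bridge_sub,
    add_sub_add_comm, mul_comm 2 e, mul_assoc]
  gcongr
  refine (norm_bridge_le _).trans ?_
  gcongr
  exact (norm_add_le _ _).trans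
    (add_le_add (norm_primitive_comp_sub_le hF hL0 hL y z) le_rfl)

/-- Continuity of `Φ` is what makes the solution `Φ (M ω)` measurable in `ω`. -/
lemma exists_continuous_solution
    (hF : ∀ y : C(unitInterval, ℝ), IntervalIntegrable (fun s => F s (ext y s)) volume 0 1)
    (hL0 : 0 ≤ L) (hL : ∀ t ∈ Icc (0 : ℝ) 1, ∀ x x', |F t x - F t x'| ≤ L * |x - x'|)
    (he : 0 ≤ e) (hcontr : 2 * e * L ≤ 1 / 2) :
    ∃ Φ : C(unitInterval, ℝ) → C(unitInterval, ℝ), Continuous Φ ∧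
      (∀ m, solutionMap F e m (Φ m) = Φ m) ∧ ∀ m y, solutionMap F e m y = y → y = Φ m := by
  have hK (m : C(unitInterval, ℝ)) : ContractingWith (1 / 2) (solutionMap F e m) := by
    refine ⟨by norm_num, LipschitzWith.of_dist_le_mul fun y z => ?_⟩
    rw [dist_eq_norm, dist_eq_norm]
    refine (norm_solutionMap_sub_le hF hL0 hL he m m y z).trans ?_
    rw [sub_self, norm_zero, add_zero, ← mul_assoc]
    refine mul_le_mul_of_nonneg_right (hcontr.trans_eq ?_) (norm_nonneg _)
    simp
  refine ⟨fun m => ContractingWith.fixedPoint _ (hK m), ?_, fun m => (hK m).fixedPoint_isFixedPt,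
    fun m y hy => (hK m).fixedPoint_unique hy⟩
  -- The constant is `2e / (1 - 1/2)`: the shift of the map divided by one minus its contraction
  -- factor.
  refine LipschitzWith.continuous (K := (4 * e).toNNReal)
    (LipschitzWith.of_dist_le_mul fun m m' => ?_)
  refine ((hK m).fixedPoint_lipschitz_in_map (hK m') (C := 2 * e * ‖m - m'‖) fun z => ?_).trans ?_
  · rw [dist_eq_norm]
    simpa using norm_solutionMap_sub_le hF hL0 hL he m m' z z
  · rw [Real.coe_toNNReal _ (by positivity), dist_eq_norm]
    refine le_of_eq ?_
    simp only [NNReal.coe_div, NNReal.coe_one, NNReal.coe_ofNat]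
    ring

/-- For a solution `y` of the Dirichlet problem, `e⁻¹ y` is close to the solution of the linear
problem with right-hand side `F(·, 0)`. -/
lemma norm_smul_sub_bridge_le
    (hF : ∀ y : C(unitInterval, ℝ), IntervalIntegrable (fun s => F s (ext y s)) volume 0 1)
    (hL0 : 0 ≤ L) (hL : ∀ t ∈ Icc (0 : ℝ) 1, ∀ x x', |F t x - F t x'| ≤ L * |x - x'|)
    (he : 0 < e) (hcontr : 2 * e * L ≤ 1 / 2) {m y : C(unitInterval, ℝ)}
    (hy : solutionMap F e m y = y) :
    ‖e⁻¹ • y - bridge (primitive (fun s => F s 0) + m)‖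
      ≤ 8 * e * L * (‖primitive (fun s => F s 0)‖ + ‖m‖) := by
  have hprim := norm_primitive_comp_sub_le hF hL0 hL y 0
  have h0 : (fun s => F s (ext 0 s)) = fun s => F s 0 := rfl
  rw [h0, sub_zero] at hprim
  -- From `‖y‖ ≤ 2e (L ‖y‖ + N)` and `2eL ≤ 1/2`, the term in `‖y‖` is absorbed on the left,
  -- doubling the constant. A further factor `2L` then gives `8eL`.
  have hnorm : ‖y‖ ≤ 4 * e * (‖primitive (fun s => F s 0)‖ + ‖m‖) := by
    have h1 : ‖primitive (fun s => F s (ext y s)) + m‖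
        ≤ L * ‖y‖ + (‖primitive (fun s => F s 0)‖ + ‖m‖) := by
      have h2 := norm_sub_norm_le (primitive fun s => F s (ext y s)) (primitive fun s => F s 0)
      have h3 := norm_add_le (primitive fun s => F s (ext y s)) m
      linarith
    have h2 : ‖y‖ ≤ e * (2 * (L * ‖y‖ + (‖primitive (fun s => F s 0)‖ + ‖m‖))) := by
      conv_lhs => rw [← hy, solutionMap, norm_smul, Real.norm_of_nonneg he.le]
      gcongr
      exact (norm_bridge_le _).trans (by gcongr)
    nlinarith [norm_nonneg y]
  have heq : e⁻¹ • y = bridge (primitive (fun s => F s (ext y s)) + m) := by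
    conv_lhs => rw [← hy, solutionMap, smul_smul, inv_mul_cancel₀ he.ne', one_smul]
  rw [heq, ← bridge_sub, add_sub_add_right_eq_sub]
  refine (norm_bridge_le _).trans ?_
  have := mul_le_mul_of_nonneg_left hnorm hL0
  linarith

/-- One half of the equivalence between the differential problem and the fixed-point equation. The
condition `m 0 = 0` makes the slope at `0` absorb exactly the constant `-e ∫_0^1 H`. -/
lemma derivWithin_ext_of_solutionMap_eq
    (hF : ∀ y : C(unitInterval, ℝ), IntervalIntegrable (fun s => F s (ext y s)) volume 0 1)
    {m y : C(unitInterval, ℝ)} (hm : m 0 = 0) (hy : solutionMap F e m y = y) :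
    ContDiffOn ℝ 1 (ext y) (Icc 0 1) ∧ y 0 = 0 ∧ y 1 = 0 ∧ ∀ t : unitInterval,
      derivWithin (ext y) (Icc 0 1) t = derivWithin (ext y) (Icc 0 1) 0
        + e * (∫ s in (0 : ℝ)..t, F s (ext y s)) + e * m t := by
  set H := primitive (fun s => F s (ext y s)) + m with hH
  have happ (t : unitInterval) : y t = e * bridgeFun H t := by
    conv_lhs => rw [← hy]
    rfl
  have heq : EqOn (ext y) (fun t => e * bridgeFun H t) (Icc 0 1) := fun t ht => by
    rw [ext_of_mem y ht, happ]
  have hderiv (t : unitInterval) : derivWithin (ext y) (Icc 0 1) t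
      = e * (H t - ∫ u in (0 : ℝ)..1, ext H u) := by
    rw [derivWithin_congr heq (heq t.2)]
    have := ((hasDerivAt_bridgeFun H t).const_mul e).hasDerivWithinAt (s := Icc 0 1)
    rw [this.derivWithin ((uniqueDiffOn_Icc zero_lt_one) _ t.2), ext_of_mem H t.2]
  refine ⟨(contDiff_const.mul (contDiff_bridgeFun H)).contDiffOn.congr heq, ?_, ?_, fun t => ?_⟩
  · simp [happ, bridgeFun_zero]
  · simp [happ, bridgeFun_one]
  · have h0 := hderiv 0
    rw [Icc.coe_zero] at h0
    rw [hderiv, h0, hH, ContinuousMap.add_apply, ContinuousMap.add_apply, primitive_apply (hF y),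
      primitive_apply (hF y), hm, Icc.coe_zero, intervalIntegral.integral_same]
    ring

/-- The other half: integrating once more gives `y t = c t + e ∫_0^t H`, and `y 1 = 0` forces `c =
-e ∫_0^1 H`. -/
lemma solutionMap_eq_of_derivWithin
    (hF : ∀ y : C(unitInterval, ℝ), IntervalIntegrable (fun s => F s (ext y s)) volume 0 1)
    {m y : C(unitInterval, ℝ)} (hd : ContDiffOn ℝ 1 (ext y) (Icc 0 1)) (h0 : y 0 = 0)
    (h1 : y 1 = 0)
    (heq : ∀ t : unitInterval, derivWithin (ext y) (Icc 0 1) t = derivWithin (ext y) (Icc 0 1) 0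
        + e * (∫ s in (0 : ℝ)..t, F s (ext y s)) + e * m t) :
    solutionMap F e m y = y := by
  set H := primitive (fun s => F s (ext y s)) + m with hH
  set c := derivWithin (ext y) (Icc 0 1) 0
  have hderiv (t : ℝ) (ht : t ∈ Icc (0 : ℝ) 1) :
      derivWithin (ext y) (Icc 0 1) t = c + e * ext H t := by
    have := heq ⟨t, ht⟩
    simp only at this
    rw [this, ext_of_mem H ht, hH, ContinuousMap.add_apply, primitive_apply (hF y)]
    ring
  have hint (t : unitInterval) : y t = c * t + e * ∫ u in (0 : ℝ)..t, ext H u := by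
    have hcH : Continuous fun u => c + e * ext H u :=
      continuous_const.add (continuous_const.mul (continuous_ext H))
    have h := intervalIntegral.integral_eq_sub_of_hasDerivAt_of_le (f := ext y)
      (f' := fun u => c + e * ext H u) t.2.1 (continuous_ext y).continuousOn (fun u hu => ?_)
      (hcH.intervalIntegrable _ _)
    · have hi : IntervalIntegrable (fun u => e * ext H u) volume 0 t :=
        (continuous_const.mul (continuous_ext H)).intervalIntegrable _ _
      rw [intervalIntegral.integral_add intervalIntegrable_const hi,
        intervalIntegral.integral_const, intervalIntegral.integral_const_mul,
        ext_of_mem y t.2, ext_of_mem y ⟨le_rfl, zero_le_one⟩] at h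
      have h0' : y ⟨0, ⟨le_rfl, zero_le_one⟩⟩ = 0 := h0
      rw [h0', sub_zero, sub_zero, smul_eq_mul] at h
      linarith
    · have hu1 : u ∈ Icc (0 : ℝ) 1 := ⟨hu.1.le, hu.2.le.trans t.2.2⟩
      have hnhds : Icc (0 : ℝ) 1 ∈ 𝓝 u := Icc_mem_nhds hu.1 (hu.2.trans_le t.2.2)
      have h2 := ((hd.differentiableOn one_ne_zero) u hu1).hasDerivWithinAt
      rw [hderiv u hu1] at h2
      exact h2.hasDerivAt hnhds
  have hone := hint 1
  rw [h1, Icc.coe_one, mul_one] at hone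
  ext t
  change e * bridgeFun H t = y t
  rw [hint t, bridgeFun]
  linear_combination (t : ℝ) * hone

end FixedPoint

/-! ### Regularity of the drift -/

section Superposition

/-- The superposition of a Carathéodory function with a continuous function is measurable. -/
lemma aestronglyMeasurable_superposition {B : ℝ → ℝ → ℝ} {s : Set ℝ} (hs : MeasurableSet s)
    (hB : ∀ x, AEMeasurable (fun t => B t x) (volume.restrict s))
    (hc : ∀ t ∈ s, Continuous (B t)) {y : ℝ → ℝ} (hy : Measurable y) :
    AEStronglyMeasurable (fun t => B t (y t)) (volume.restrict s) := by
  -- The null set on which a measurable version differs depends on `x`. Rational `x` share one null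
  -- set, and continuity in `x` carries measurability off it to all real `x`.
  have hall : ∀ᵐ t ∂(volume.restrict s), ∀ q : ℚ, B t q = (hB q).mk _ t :=
    ae_all_iff.2 fun q => (hB q).ae_eq_mk
  have hboth := hall.and (ae_restrict_mem hs)
  obtain ⟨N, hN, hNm, hN0⟩ := exists_measurable_superset_of_null (ae_iff.1 hboth)
  have hmem {t : ℝ} (ht : t ∈ Nᶜ) : (∀ q : ℚ, B t q = (hB q).mk _ t) ∧ t ∈ s := by
    by_contra h
    exact ht (hN h)
  set u : ℝ → ℝ → ℝ := fun x => Nᶜ.indicator fun t => B t x with hu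
  have hucont (t : ℝ) : Continuous fun x => u x t := by
    by_cases ht : t ∈ Nᶜ
    · simpa only [hu, indicator_of_mem ht] using hc t (hmem ht).2
    · simpa only [hu, indicator_of_notMem ht] using continuous_const
  have hurat (q : ℚ) : Measurable (u q) := by
    have : u q = Nᶜ.indicator ((hB q).mk _) := by
      ext t
      by_cases ht : t ∈ Nᶜ
      · simp only [hu, indicator_of_mem ht, (hmem ht).1 q]
      · simp only [hu, indicator_of_notMem ht]
    rw [this]
    exact (hB q).measurable_mk.indicator hNm.compl
  have humeas (x : ℝ) : Measurable (u x) := by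
    obtain ⟨q, -, -, hq⟩ := Real.exists_seq_rat_strictMono_tendsto x
    exact measurable_of_tendsto_metrizable (fun n => hurat (q n))
      (tendsto_pi_nhds.2 fun t => ((hucont t).tendsto x).comp hq)
  have hjoint := measurable_uncurry_of_continuous_of_measurable hucont humeas
  refine ⟨fun t => u (y t) t, (hjoint.comp (hy.prodMk measurable_id)).stronglyMeasurable, ?_⟩
  have hNae : ∀ᵐ t ∂(volume.restrict s), t ∈ Nᶜ := by
    rw [ae_iff]
    simpa using hN0
  filter_upwards [hNae] with t ht
  simp only [hu, indicator_of_mem ht]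

variable {A B : ℝ → ℝ → ℝ} {p : ℝ} {f : ℝ → ℝ}

/-- The mean value inequality gives the constant `p + β`, which is at most `2p` because `β < p`. -/
lemma abs_sub_le_of_conditions (hC1 : ConditionC1 A p B) (hC2 : ConditionC2 p B) {t : ℝ}
    (ht : t ∈ Icc (0 : ℝ) 1) (x x' : ℝ) :
    |(A t x + f t) - (A t x' + f t)| ≤ 2 * p * |x - x'| := by
  obtain ⟨β, hβp, hβ⟩ := hC2.deriv_bound
  have hlip : |B t x - B t x'| ≤ β * |x - x'| :=
    Convex.norm_image_sub_le_of_norm_deriv_le (fun z _ => hC2.differentiable t ht z)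
      (fun z _ => hβ t ht z) convex_univ (mem_univ x') (mem_univ x)
  rw [add_sub_add_right_eq_sub, hC1.eq_add t ht, hC1.eq_add t ht]
  have h1 : p * x + B t x - (p * x' + B t x') = p * (x - x') + (B t x - B t x') := by ring
  rw [h1]
  refine (abs_add_le _ _).trans ?_
  rw [abs_mul, abs_of_pos hC1.p_pos]
  nlinarith [abs_nonneg (x - x')]

lemma intervalIntegrable_superposition (hC1 : ConditionC1 A p B) (hC2 : ConditionC2 p B)
    (hB : ∀ x : ℝ, AEMeasurable (fun t => B t x) (volume.restrict (Icc (0 : ℝ) 1)))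
    (hf : IntegrableOn f (Icc (0 : ℝ) 1) volume) (y : C(unitInterval, ℝ)) :
    IntervalIntegrable (fun s => A s (ext y s) + f s) volume 0 1 := by
  rw [intervalIntegrable_iff_integrableOn_Icc_of_le zero_le_one]
  obtain ⟨b, hb⟩ := hC1.bounded
  have hBi : IntegrableOn (fun s => B s (ext y s)) (Icc 0 1) :=
    Integrable.of_bound (aestronglyMeasurable_superposition measurableSet_Icc hB
      (fun t ht => (hC2.differentiable t ht).continuous) (continuous_ext y).measurable) b
      ((ae_restrict_mem measurableSet_Icc).mono fun s hs => hb s hs _)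
  have hy : IntegrableOn (fun s => p * ext y s) (Icc 0 1) :=
    (continuous_const.mul (continuous_ext y)).integrableOn_Icc
  refine IntegrableOn.congr_fun ((hy.add hBi).add hf) (fun s hs => ?_) measurableSet_Icc
  simp [hC1.eq_add s hs]

end Superposition

/-! ### From paths to processes -/

variable {Ω : Type*} [MeasurableSpace Ω] {P : Measure Ω}

/-- Two processes with continuous paths that are versions of each other are indistinguishable. -/
lemma ae_forall_eq_of_forall_ae_eq {X Y : ℝ → Ω → ℝ}
    (hX : ∀ᵐ ω ∂P, ContinuousOn (fun t => X t ω) (Icc 0 1))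
    (hY : ∀ᵐ ω ∂P, ContinuousOn (fun t => Y t ω) (Icc 0 1))
    (h : ∀ t ∈ Icc (0 : ℝ) 1, ∀ᵐ ω ∂P, X t ω = Y t ω) :
    ∀ᵐ ω ∂P, ∀ t ∈ Icc (0 : ℝ) 1, X t ω = Y t ω := by
  set q := TopologicalSpace.denseSeq unitInterval
  have hq : ∀ᵐ ω ∂P, ∀ n, X (q n) ω = Y (q n) ω := ae_all_iff.2 fun n => h _ (q n).2
  filter_upwards [hX, hY, hq] with ω h1 h2 h3 t ht
  have := (TopologicalSpace.denseRange_denseSeq unitInterval).equalizer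
    (continuousOn_iff_continuous_domRestrict.1 h1)
    (continuousOn_iff_continuous_domRestrict.1 h2) (funext h3)
  exact congrFun this ⟨t, ht⟩

variable {W : ℝ → Ω → ℝ} {A B : ℝ → ℝ → ℝ} {p : ℝ} {f δ : ℝ → ℝ}

lemma ae_apply_zero_eq_zero (hW : IsBrownianOnUnit W P) {M : Ω → C(unitInterval, ℝ)}
    (hM : ∀ t : unitInterval,
      IsWienerIntegral W P ((Ioc 0 (t : ℝ)).indicator δ) (fun ω => M ω t)) :
    ∀ᵐ ω ∂P, M ω 0 = 0 := by
  have h0 : (Ioc (0 : ℝ) ((0 : unitInterval) : ℝ)).indicator δ = 0 := by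
    ext s
    simp
  have h := hM 0
  rw [h0] at h
  have hle := h.eLpNorm_le hW aestronglyMeasurable_zero
  rw [eLpNorm_zero, nonpos_iff_eq_zero, eLpNorm_eq_zero_iff h.1.1 (by norm_num)] at hle
  exact hle

/-- Almost every path of a solution of the Dirichlet problem is a fixed point of `solutionMap`. -/
lemma IsDirichletSolution.ae_exists_solutionMap_eq (hW : IsBrownianOnUnit W P)
    (hδ : MemLp δ 2 (volume.restrict (Icc (0 : ℝ) 1)))
    (hF : ∀ y : C(unitInterval, ℝ), IntervalIntegrable (fun s => A s (ext y s) + f s) volume 0 1)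
    {M : Ω → C(unitInterval, ℝ)}
    (hM : ∀ t : unitInterval,
      IsWienerIntegral W P ((Ioc 0 (t : ℝ)).indicator δ) (fun ω => M ω t))
    {ε : ℝ} {x : ℝ → Ω → ℝ} (hx : IsDirichletSolution W P A f δ ε x) :
    ∀ᵐ ω ∂P, ∃ y : C(unitInterval, ℝ), (∀ t ∈ Icc (0 : ℝ) 1, x t ω = ext y t) ∧
      solutionMap (fun s z => A s z + f s) (ε ^ 2) (M ω) y = y := by
  have hpath : ∀ᵐ ω ∂P, ∃ y : C(unitInterval, ℝ), (∀ t ∈ Icc (0 : ℝ) 1, x t ω = ext y t) ∧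
      ContDiffOn ℝ 1 (ext y) (Icc 0 1) := by
    filter_upwards [hx.contDiff] with ω hω
    have heq : ∀ t ∈ Icc (0 : ℝ) 1, x t ω
        = ext ⟨_, continuousOn_iff_continuous_domRestrict.1 hω.continuousOn⟩ t := by
      intro t ht
      rw [ext_of_mem _ ht]
      rfl
    exact ⟨_, heq, hω.congr fun t ht => (heq t ht).symm⟩
  have hint {y : C(unitInterval, ℝ)} {ω : Ω} (hy : ∀ t ∈ Icc (0 : ℝ) 1, x t ω = ext y t) {t : ℝ}
      (ht : t ∈ Icc (0 : ℝ) 1) : ∫ s in (0 : ℝ)..t, (A s (x s ω) + f s)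
        = primitive (fun s => A s (ext y s) + f s) ⟨t, ht⟩ := by
    rw [primitive_apply (hF y)]
    refine intervalIntegral.integral_congr fun s hs => ?_
    rw [uIcc_of_le ht.1] at hs
    simp only [hy s ⟨hs.1, hs.2.trans ht.2⟩]
  -- The equation holds for each `t` off a null set depending on `t`. Both sides are continuous in
  -- `t`, so a single null set works for all times.
  have hall : ∀ᵐ ω ∂P, ∀ t ∈ Icc (0 : ℝ) 1, timeDeriv x t ω = timeDeriv x 0 ω
      + ε ^ 2 * (∫ s in (0 : ℝ)..t, (A s (x s ω) + f s)) + ε ^ 2 * ext (M ω) t := by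
    refine ae_forall_eq_of_forall_ae_eq ?_ ?_ fun t ht => ?_
    · filter_upwards [hx.contDiff] with ω hω
      exact hω.continuousOn_derivWithin (uniqueDiffOn_Icc zero_lt_one) le_rfl
    · filter_upwards [hpath] with ω hω
      obtain ⟨y, hy, -⟩ := hω
      have hc : ContinuousOn (fun t => timeDeriv x 0 ω
          + ε ^ 2 * ext (primitive (fun s => A s (ext y s) + f s)) t + ε ^ 2 * ext (M ω) t)
          (Icc 0 1) :=
        ((continuous_const.add (continuous_const.mul (continuous_ext _))).add
          (continuous_const.mul (continuous_ext _))).continuousOn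
      refine hc.congr fun t ht => ?_
      simp only [hint hy ht, ext_of_mem _ ht]
    · filter_upwards [hx.equation t ht, (hM ⟨t, ht⟩).wienerIntegral_ae_eq hW
        (hδ.1.indicator measurableSet_Ioc)] with ω h1 h2
      rw [h1, ext_of_mem _ ht, h2]
  filter_upwards [hpath, hall, hx.left_boundary, hx.right_boundary] with ω h1 h2 h3 h4
  obtain ⟨y, hy, hyd⟩ := h1
  refine ⟨y, hy, solutionMap_eq_of_derivWithin hF hyd ?_ ?_ fun t => ?_⟩
  · rw [← h3, hy 0 ⟨le_rfl, zero_le_one⟩, ext_of_mem]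
    rfl
  · rw [← h4, hy 1 ⟨zero_le_one, le_rfl⟩, ext_of_mem]
    rfl
  · have hd {r : ℝ} (hr : r ∈ Icc (0 : ℝ) 1) :
        derivWithin (ext y) (Icc 0 1) r = timeDeriv x r ω :=
      derivWithin_congr (fun s hs => (hy s hs).symm) (hy r hr).symm
    rw [hd t.2, hd ⟨le_rfl, zero_le_one⟩, h2 t t.2, hint hy t.2, ext_of_mem _ t.2,
      primitive_apply (hF y)]

lemma isDirichletSolution_of_solutionMap_eq (hW : IsBrownianOnUnit W P)
    (hδ : MemLp δ 2 (volume.restrict (Icc (0 : ℝ) 1)))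
    (hF : ∀ y : C(unitInterval, ℝ), IntervalIntegrable (fun s => A s (ext y s) + f s) volume 0 1)
    {M Y : Ω → C(unitInterval, ℝ)}
    (hM : ∀ t : unitInterval,
      IsWienerIntegral W P ((Ioc 0 (t : ℝ)).indicator δ) (fun ω => M ω t))
    (hYm : AEStronglyMeasurable Y P) {ε : ℝ}
    (hY : ∀ ω, solutionMap (fun s z => A s z + f s) (ε ^ 2) (M ω) (Y ω) = Y ω) :
    IsDirichletSolution W P A f δ ε (fun t ω => ext (Y ω) t) := by
  have h0 : (0 : ℝ) ∈ Icc (0 : ℝ) 1 := ⟨le_rfl, zero_le_one⟩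
  have h1 : (1 : ℝ) ∈ Icc (0 : ℝ) 1 := ⟨zero_le_one, le_rfl⟩
  have hsol : ∀ᵐ ω ∂P, ContDiffOn ℝ 1 (ext (Y ω)) (Icc 0 1) ∧ Y ω 0 = 0 ∧ Y ω 1 = 0 ∧
      ∀ t : unitInterval, derivWithin (ext (Y ω)) (Icc 0 1) t
        = derivWithin (ext (Y ω)) (Icc 0 1) 0
          + ε ^ 2 * (∫ s in (0 : ℝ)..t, (A s (ext (Y ω) s) + f s)) + ε ^ 2 * M ω t := by
    filter_upwards [ae_apply_zero_eq_zero hW hM] with ω hω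
    exact derivWithin_ext_of_solutionMap_eq hF hω (hY ω)
  constructor
  · intro t ht
    simp only [ext_of_mem _ ht]
    exact ((continuous_eval_const (⟨t, ht⟩ : unitInterval)).comp_aestronglyMeasurable
      hYm).aemeasurable
  · exact hsol.mono fun ω hω => hω.1
  · filter_upwards [hsol] with ω hω
    rw [ext_of_mem _ h0]
    exact hω.2.1
  · filter_upwards [hsol] with ω hω
    rw [ext_of_mem _ h1]
    exact hω.2.2.1
  · intro t ht
    filter_upwards [hsol, (hM ⟨t, ht⟩).wienerIntegral_ae_eq hW
      (hδ.1.indicator measurableSet_Ioc)] with ω hω h2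
    rw [h2]
    exact hω.2.2.2 ⟨t, ht⟩

lemma bridgeFun_primitive {h : ℝ → ℝ} (hh : IntervalIntegrable h volume 0 1) {t : ℝ}
    (ht : t ∈ Icc (0 : ℝ) 1) :
    bridgeFun (primitive h) t = ∫ s in (0 : ℝ)..1, upsilon t s * h s := by
  have hc {r : ℝ} (hr : r ∈ Icc (0 : ℝ) 1) :
      ∫ u in (0 : ℝ)..r, ext (primitive h) u = ∫ u in (0 : ℝ)..r, ∫ s in (0 : ℝ)..u, h s := by
    refine intervalIntegral.integral_congr fun u hu => ?_
    rw [uIcc_of_le hr.1] at hu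
    simp only [ext_of_mem _ (⟨hu.1, hu.2.trans hr.2⟩ : u ∈ Icc (0 : ℝ) 1), primitive_apply hh]
  rw [integral_upsilon_mul hh ht, bridgeFun, hc ht, hc ⟨zero_le_one, le_rfl⟩]

/-- By linearity of `bridge` the drift part gives the deterministic integral and `M` gives the
Wiener integral. At `x = 0` the linear term of `A` vanishes, so `A` may stand for `B`. -/
lemma isLimitProcess_bridge (hW : IsBrownianOnUnit W P)
    (hδ : MemLp δ 2 (volume.restrict (Icc (0 : ℝ) 1))) (hC1 : ConditionC1 A p B)
    (hF : ∀ y : C(unitInterval, ℝ), IntervalIntegrable (fun s => A s (ext y s) + f s) volume 0 1)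
    {M : Ω → C(unitInterval, ℝ)}
    (hM : ∀ t : unitInterval,
      IsWienerIntegral W P ((Ioc 0 (t : ℝ)).indicator δ) (fun ω => M ω t)) :
    IsLimitProcess W P B f δ
      (fun t ω => ext (bridge (primitive (fun s => A s 0 + f s) + M ω)) t) := by
  have hF0 : IntervalIntegrable (fun s => A s 0 + f s) volume 0 1 := hF 0
  refine ⟨ae_of_all _ fun ω => (continuous_ext _).continuousOn, fun t ht => ?_⟩
  have hm : AEStronglyMeasurable (fun s => upsilon t s * δ s)
      (volume.restrict (Icc (0 : ℝ) 1)) := by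
    refine Continuous.aestronglyMeasurable ?_ |>.mul hδ.1
    unfold upsilon
    fun_prop
  filter_upwards [(isWienerIntegral_bridge hW hδ hM ht).wienerIntegral_ae_eq hW hm] with ω hω
  have hadd : bridgeFun (primitive (fun s => A s 0 + f s)) t
      = bridgeFun (primitive (fun s => A s 0 + f s) + M ω) t - bridgeFun (M ω) t := by
    have h1 := bridge_sub (primitive (fun s => A s 0 + f s) + M ω) (M ω)
    rw [add_sub_cancel_right] at h1
    exact congrArg (fun y : C(unitInterval, ℝ) => y ⟨t, ht⟩) h1
  have hB : ∫ s in (0 : ℝ)..1, upsilon t s * (B s 0 + f s)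
      = ∫ s in (0 : ℝ)..1, upsilon t s * (A s 0 + f s) := by
    refine intervalIntegral.integral_congr fun s hs => ?_
    rw [uIcc_of_le zero_le_one] at hs
    simp only [hC1.eq_add s hs, mul_zero, zero_add]
  rw [hω, hB, ← bridgeFun_primitive hF0 ht, ext_of_mem _ ht, bridge_apply, hadd]
  exact (sub_add_cancel _ _).symm

/-- Along any sequence tending to `0` the variables converge to `0` on every path, hence in measure.
-/
lemma tendsto_measure_le_enorm_sq_mul [IsFiniteMeasure P] {Z : Ω → ℝ}
    (hZ : AEStronglyMeasurable Z P) {η : ℝ≥0∞} (hη : 0 < η) :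
    Tendsto (fun ε : ℝ => P {ω | η ≤ ‖ε ^ 2 * Z ω‖ₑ}) (𝓝[>] 0) (𝓝 0) := by
  refine tendsto_of_seq_tendsto fun u hu => ?_
  have hu0 : Tendsto (fun n => u n ^ 2) atTop (𝓝 0) := by
    simpa using (hu.mono_right nhdsWithin_le_nhds).pow 2
  have h := tendstoInMeasure_of_tendsto_ae (μ := P) (f := fun n ω => u n ^ 2 * Z ω)
    (g := fun _ => 0) (fun n => hZ.const_mul _)
    (ae_of_all _ fun ω => by simpa using hu0.mul_const (Z ω)) η hη
  simpa only [edist_zero_right, Function.comp_def] using h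

end BVP

theorem theorem3p1 {Ω : Type*} [MeasurableSpace Ω] (P : Measure Ω) [IsProbabilityMeasure P]
    (W : ℝ → Ω → ℝ) (hW : BVP.IsBrownianOnUnit W P)
    (A B : ℝ → ℝ → ℝ) (p : ℝ) (f δ : ℝ → ℝ)
    (hC1 : BVP.ConditionC1 A p B) (hC2 : BVP.ConditionC2 p B)
    (hB : ∀ x : ℝ, AEMeasurable (fun t => B t x) (volume.restrict (Icc (0 : ℝ) 1)))
    (hf : IntegrableOn f (Icc (0 : ℝ) 1) volume)
    (hδ : MemLp δ 2 (volume.restrict (Icc (0 : ℝ) 1))) :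
    (∃ κ : ℝ → Ω → ℝ, BVP.IsLimitProcess W P B f δ κ) ∧
    ∃ ε₀ : ℝ, 0 < ε₀ ∧
      (∀ ε ∈ Ioc (0 : ℝ) ε₀, ∃ x : ℝ → Ω → ℝ, BVP.IsDirichletSolution W P A f δ ε x ∧
        ∀ y : ℝ → Ω → ℝ, BVP.IsDirichletSolution W P A f δ ε y →
          ∀ᵐ ω ∂P, ∀ t ∈ Icc (0 : ℝ) 1, y t ω = x t ω) ∧
      ∀ x : ℝ → ℝ → Ω → ℝ,
        (∀ ε ∈ Ioc (0 : ℝ) ε₀, BVP.IsDirichletSolution W P A f δ ε (x ε)) →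
        ∀ κ : ℝ → Ω → ℝ, BVP.IsLimitProcess W P B f δ κ →
          ∀ η : ℝ≥0∞, 0 < η →
            Tendsto
              (fun ε : ℝ => P {ω | η ≤ BVP.uniformNorm (fun t => (ε ^ 2)⁻¹ * x ε t ω - κ t ω)})
              (𝓝[>] 0) (𝓝 0) := by
  obtain ⟨M, hMm, hM⟩ := BVP.exists_continuous_wienerIntegral hW hδ
  have hp := hC1.p_pos
  have hF := BVP.intervalIntegrable_superposition hC1 hC2 hB hf
  have hL (t : ℝ) (ht : t ∈ Icc (0 : ℝ) 1) (z z' : ℝ) :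
      |(A t z + f t) - (A t z' + f t)| ≤ 2 * p * |z - z'| :=
    BVP.abs_sub_le_of_conditions hC1 hC2 ht z z'
  have hL0 : 0 ≤ 2 * p := by positivity
  have hlim := BVP.isLimitProcess_bridge hW hδ hC1 hF hM
  -- The threshold `ε₀² = 1 / (8p)` is the contraction condition `2 ε² L ≤ 1/2` with `L = 2p`.
  have hsmall {ε : ℝ} (hε : ε ∈ Ioc 0 √(1 / (8 * p))) : 2 * ε ^ 2 * (2 * p) ≤ 1 / 2 := by
    have h := (Real.le_sqrt hε.1.le (by positivity)).1 hε.2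
    rw [le_div_iff₀ (by positivity)] at h
    linarith
  refine ⟨⟨_, hlim⟩, √(1 / (8 * p)), Real.sqrt_pos.2 (by positivity), fun ε hε => ?_,
    fun x hx κ hκ η hη => ?_⟩
  · obtain ⟨Φ, hΦc, hΦ, hΦu⟩ :=
      BVP.exists_continuous_solution hF hL0 hL (sq_nonneg ε) (hsmall hε)
    refine ⟨_, BVP.isDirichletSolution_of_solutionMap_eq hW hδ hF hM
      (hΦc.comp_aestronglyMeasurable hMm) fun ω => hΦ (M ω), fun y hy => ?_⟩
    filter_upwards [hy.ae_exists_solutionMap_eq hW hδ hF hM] with ω hω t ht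
    obtain ⟨z, hz, hzs⟩ := hω
    rw [hz t ht, hΦu (M ω) z hzs]
  · set K := BVP.primitive (fun s => A s 0 + f s)
    -- Any admissible version of `κ` is indistinguishable from the explicit one, so the pathwise
    -- estimate transfers to it.
    have hκeq := BVP.ae_forall_eq_of_forall_ae_eq hκ.continuous_paths hlim.continuous_paths
      fun t ht => by
        filter_upwards [hκ.formula t ht, hlim.formula t ht] with ω h1 h2
        rw [h1, h2]
    -- `ε ^ 2 * Z ω` is the pathwise error bound; `Z` is finite everywhere and does not depend on
    -- `ε`.
    set Z : Ω → ℝ := fun ω => 8 * (2 * p) * (‖K‖ + ‖M ω‖) with hZ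
    have hZm : AEStronglyMeasurable Z P := (aestronglyMeasurable_const.add hMm.norm).const_mul _
    have hbound (ε : ℝ) (hε : ε ∈ Ioc 0 √(1 / (8 * p))) :
        P {ω | η ≤ BVP.uniformNorm (fun t => (ε ^ 2)⁻¹ * x ε t ω - κ t ω)}
          ≤ P {ω | η ≤ ‖ε ^ 2 * Z ω‖ₑ} := by
      refine measure_mono_ae ?_
      filter_upwards [(hx ε hε).ae_exists_solutionMap_eq hW hδ hF hM, hκeq] with ω h1 h2 h3
      obtain ⟨y, hy, hys⟩ := h1
      refine (show η ≤ BVP.uniformNorm _ from h3).trans (iSup₂_le fun t ht => ?_)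
      have hb := BVP.norm_smul_sub_bridge_le hF hL0 hL (pow_pos hε.1 2) (hsmall hε) hys
      beta_reduce
      rw [hy t ht, h2 t ht, BVP.ext_of_mem _ ht, BVP.ext_of_mem _ ht, enorm_le_iff_norm_le]
      refine (((ε ^ 2)⁻¹ • y - BVP.bridge (K + M ω)).norm_coe_le_norm ⟨t, ht⟩).trans
        (hb.trans ((le_of_eq ?_).trans (le_abs_self _)))
      rw [hZ]
      ring
    refine tendsto_of_tendsto_of_tendsto_of_le_of_le' tendsto_const_nhds
      (BVP.tendsto_measure_le_enorm_sq_mul hZm hη) (Eventually.of_forall fun _ => zero_le) ?_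
    filter_upwards [Ioc_mem_nhdsGT (Real.sqrt_pos.2 (by positivity : 0 < 1 / (8 * p)))] with ε hε
    exact hbound ε hε
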